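/- Let $d\in\{2,3\}$ and let $\Omega\subset\mathbb R^d$ be a bounded domain with polygonal (polyhedral) boundary, namely the interior of the union of the elements of a finite conforming triangulation $\tau_h$ into closed triangles (tetrahedra). Let $A\in L^\infty(\Omega)^{d\times d}$ be symmetric with $\alpha|\zeta|^2\le A(x)\zeta\cdot\zeta\le\beta|\zeta|^2$ for all $\zeta\in\mathbb R^d$ and a.e. $x\in\Omega$, where $0<\alpha<\beta<\infty$. For open $\omega\subset\Omega$ put $a_\omega(u,v)=\int_\omega A\nabla u\cdot\nabla v\,dx$, $\|u\|_{a,\omega}=a_\omega(u,u)^{1/2}$, $a=a_\Omega$, $\|\cdot\|_a=\|\cdot\|_{a,\Omega}$. Let $V_h\subset H^1_0(\Omega)$ be the Lagrange finite element space of continuous functions that vanish on $\partial\Omega$ and are polynomials of degree at most $p$ on each element ($p\ge1$), and let $I_h$ be Lagrange interpolation into $V_h$ (at the points with barycentric coordinates in $\frac1p\mathbb Z$). Put $V_h(\omega)=\{v|_\omega: v\in V_h\}$, and let $V_{h,0}(\omega)$ be the space of $v\in V_h$ with $\operatorname{supp}v\subset\overline\omega$ (also regarded as functions on $\omega$). Let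 $\ell$ be a linear functional on $V_h$, and let $u_h\in V_h$ be the solution of $a(u_h,v)=\ell(v)$ for all $v\in V_h$. Let $\Omega=\bigcup_{i=1}^M\omega_i$ and $\omega_i\subset\omega_i^*\subset\Omega$, where all $\omega_i,\omega_i^*$ are resolved by $\tau_h$ (interiors of unions of elements). Let $\xi=\max_{x\in\Omega}\#\{i: x\in\omega_i\}$ and $\xi^*=\max_{x\in\Omega}\#\{i: x\in\omega_i^*\}$. Let $\chi_i:\Omega\to[0,1]$ be continuous with $\operatorname{supp}\chi_i\subset\overline{\omega_i}$ and $\sum_i\chi_i=1$ on $\Omega$, and put $\chi_{h,i}(v)=I_h(\chi_i v)$ for $v\in V_h(\omega_i)$. Let $V_{h,A}(\omega_i^*)=\{v\in V_h(\omega_i^*): a_{\omega_i^*}(v,w)=0\ \forall w\in V_{h,0}(\omega_i^*)\}$. For each $i$ let $\phi_{i,1},\dots,\phi_{i,N_i}$ be a basis of $V_{h,A}(\omega_i^*)$ consisting of eigenfunctions, with eigenvalues $\lambda_{i,1}\ge\lambda_{i,2}\ge\cdots\ge\lambda_{i,N_i}$ in $[0,\infty]$, of the problem $$a_{\omega_i}\big(\chi_{h,i}(\phi|_{\omega_i}),\chi_{h,i}(v|_{\omega_i})\big)=\lambda\,a_{\omega_i^*}(\phi,v)\qquad\text{for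 all } v\in V_{h,A}(\omega_i^*),$$ where $\lambda=+\infty$ means that $a_{\omega_i^*}(\phi,v)=0$ for all $v\in V_{h,A}(\omega_i^*)$; put $\lambda_{i,k}=0$ for $k>N_i$. Given integers $m_i\ge0$, let $S_{m_i}(\omega_i)=\operatorname{span}\{\phi_{i,j}|_{\omega_i}: j\le \min(m_i,N_i)\}$ and $S_m(\Omega)=\{\sum_i\chi_{h,i}(f_i): f_i\in S_{m_i}(\omega_i)\}$. Let $\pi_i$ and $\pi_S$ be the $a$-orthogonal projections of $V_h$ onto $V_{h,0}(\omega_i^*)$ and $S_m(\Omega)$, and define $G:V_h\to V_h$ by $$G(v)=\sum_{i=1}^M\chi_{h,i}\big((\pi_iv)|_{\omega_i}\big)+\pi_S\Big(v-\sum_{i=1}^M\chi_{h,i}\big((\pi_iv)|_{\omega_i}\big)\Big).$$ Then for every $v^0\in V_h$ the iterates $v^{j+1}=v^j+G(u_h-v^j)$ satisfy $$\|v^{j+1}-u_h\|_a\le\Lambda\,\|v^j-u_h\|_a,\qquad j=0,1,2,\dots,\qquad \Lambda=\Big(\xi\,\xi^*\max_{1\le i\le M}\lambda_{i,m_i+1}\Big)^{1/2}\in[0,\infty],$$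 with the convention $\infty\cdot0=0$. -/

import Mathlib

open scoped ENNReal Matrix
open MeasureTheory

namespace MSGFEM

noncomputable section

/-- `ℝᵈ` with its Euclidean structure. -/
abbrev E (d : ℕ) : Type := EuclideanSpace ℝ (Fin d)

/-- A conforming triangulation made of finitely many nondegenerate `d`-simplices (triangles for
`d = 2`, tetrahedra for `d = 3`). An element is given by the set of its `d + 1` vertices; two
elements meet exactly in the simplex spanned by their common vertices (possibly empty). -/
structure Triangulation (d : ℕ) where
  elements : Finset (Finset (E d))
  card_eq : ∀ s ∈ elements, s.card = d + 1
  indep : ∀ s ∈ elements, AffineIndependent ℝ ((↑) : s → E d)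
  conforming : ∀ s ∈ elements, ∀ t ∈ elements,
    convexHull ℝ (s : Set (E d)) ∩ convexHull ℝ (t : Set (E d)) =
      convexHull ℝ ((s : Set (E d)) ∩ (t : Set (E d)))

/-- The closed region covered by a collection of elements. -/
def region {d : ℕ} (S : Finset (Finset (E d))) : Set (E d) :=
  ⋃ s ∈ S, convexHull ℝ (s : Set (E d))

/-- The open polyhedral set `Ω` that is triangulated. -/
def Triangulation.domain {d : ℕ} (T : Triangulation d) : Set (E d) :=
  interior (region T.elements)

/-- An open set `ω` is resolved by the mesh if it is the interior of a union of elements. -/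
def Triangulation.Resolves {d : ℕ} (T : Triangulation d) (ω : Set (E d)) : Prop :=
  ∃ S ⊆ T.elements, ω = interior (region S)

/-- The coefficient: `A ∈ L^∞(Ω)^{d × d}`, symmetric and uniformly elliptic on `Ω`. -/
structure IsCoefficient {d : ℕ} (Ω : Set (E d)) (A : E d → Matrix (Fin d) (Fin d) ℝ) : Prop where
  measurable : ∀ i j, AEMeasurable (fun x => A x i j) (volume.restrict Ω)
  symm : ∀ᵐ x ∂(volume.restrict Ω), (A x).IsSymm
  elliptic : ∃ α β : ℝ, 0 < α ∧ α < β ∧ ∀ᵐ x ∂(volume.restrict Ω), ∀ ζ : Fin d → ℝ,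
    α * (ζ ⬝ᵥ ζ) ≤ (A x *ᵥ ζ) ⬝ᵥ ζ ∧ (A x *ᵥ ζ) ⬝ᵥ ζ ≤ β * (ζ ⬝ᵥ ζ)

/-- The bilinear form `a_ω(u, v) = ∫_ω (A ∇u) · ∇v dx`. It is applied to (restrictions of) finite
element functions only; these are piecewise polynomial and Lipschitz, so that the classical gradient
exists off the mesh skeleton, is bounded there, and is the weak gradient. -/
def energyForm {d : ℕ} (A : E d → Matrix (Fin d) (Fin d) ℝ) (ω : Set (E d))
    (u v : E d → ℝ) : ℝ :=
  ∫ x in ω, (A x *ᵥ (gradient u x).ofLp) ⬝ᵥ (gradient v x).ofLp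

/-- The energy (semi)norm `‖u‖_{a,ω} = a_ω(u, u)^{1/2}`. -/
def energyNorm {d : ℕ} (A : E d → Matrix (Fin d) (Fin d) ℝ) (ω : Set (E d))
    (u : E d → ℝ) : ℝ :=
  √(energyForm A ω u u)

/-- The finite element space `V_h ⊂ H¹₀(Ω)`: continuous functions, zero outside `Ω`, which on each
element coincide with a polynomial of total degree at most `p`. -/
def feSpace {d : ℕ} (T : Triangulation d) (p : ℕ) : Submodule ℝ (E d → ℝ) where
  carrier := {v | Continuous v ∧ (∀ x, x ∉ T.domain → v x = 0) ∧
    ∀ s ∈ T.elements, ∃ q : MvPolynomial (Fin d) ℝ, q.totalDegree ≤ p ∧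
      ∀ x ∈ convexHull ℝ (s : Set (E d)), v x = MvPolynomial.eval x.ofLp q}
  zero_mem' := ⟨continuous_const, fun _ _ => rfl, fun _ _ => ⟨0, by simp, by simp⟩⟩
  add_mem' := by
    rintro u v ⟨hu, hu0, hup⟩ ⟨hv, hv0, hvp⟩
    refine ⟨hu.add hv, fun x hx => by simp [hu0 x hx, hv0 x hx], fun s hs => ?_⟩
    obtain ⟨q, hq, hqe⟩ := hup s hs
    obtain ⟨r, hr, hre⟩ := hvp s hs
    exact ⟨q + r, (MvPolynomial.totalDegree_add q r).trans (max_le hq hr),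
      fun x hx => by simp [hqe x hx, hre x hx]⟩
  smul_mem' := by
    rintro c u ⟨hu, hu0, hup⟩
    refine ⟨hu.const_smul c, fun x hx => by simp [hu0 x hx], fun s hs => ?_⟩
    obtain ⟨q, hq, hqe⟩ := hup s hs
    exact ⟨c • q, (MvPolynomial.totalDegree_smul_le c q).trans hq,
      fun x hx => by simp [hqe x hx]⟩

/-- The restriction `v|_ω`. A function on the open set `ω` is represented by its extension by zero
to all of `ℝᵈ` (no continuity across the boundary of `ω` is meant). -/
def restr {d : ℕ} (ω : Set (E d)) : (E d → ℝ) →ₗ[ℝ] (E d → ℝ) where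
  toFun v := ω.indicator v
  map_add' u v := Set.indicator_add ω u v
  map_smul' c u := Set.indicator_const_smul ω c u

/-- `V_h(ω) = {v|_ω : v ∈ V_h}`. -/
def localSpace {d : ℕ} (T : Triangulation d) (p : ℕ) (ω : Set (E d)) :
    Submodule ℝ (E d → ℝ) :=
  (feSpace T p).map (restr ω)

/-- `V_{h,0}(ω)`, identified by zero extension with the functions of `V_h` supported in the closure
of `ω`. -/
def localSpaceZero {d : ℕ} (T : Triangulation d) (p : ℕ) (ω : Set (E d)) : Set (E d → ℝ) :=
  {v | v ∈ feSpace T p ∧ tsupport v ⊆ closure ω}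

/-- The `a`-harmonic space `V_{h,A}(ω)`. -/
def harmonicSpace {d : ℕ} (T : Triangulation d) (p : ℕ)
    (A : E d → Matrix (Fin d) (Fin d) ℝ) (ω : Set (E d)) : Set (E d → ℝ) :=
  {v | v ∈ localSpace T p ω ∧ ∀ w ∈ localSpaceZero T p ω, energyForm A ω v w = 0}

open Classical in
/-- The Lagrange nodes of degree `p`: on each element the points with barycentric coordinates
`α / p`, where `α` runs over the tuples of natural numbers with sum `p`. -/
def nodes {d : ℕ} (T : Triangulation d) (p : ℕ) : Finset (E d) :=
  T.elements.biUnion fun s =>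
    (s.piAntidiag p).image fun α : E d → ℕ => ∑ v ∈ s, ((α v : ℝ) / (p : ℝ)) • v

open Classical in
/-- The nodal (Lagrange) basis function of the node `z`: the unique function of `V_h` which is `1`
at `z` and `0` at all the other nodes. -/
def nodalBasis {d : ℕ} (T : Triangulation d) (p : ℕ) (z : E d) : E d → ℝ :=
  Classical.epsilon fun v : E d → ℝ =>
    v ∈ feSpace T p ∧ ∀ y ∈ nodes T p, v y = if y = z then 1 else 0

open Classical in
/-- The Lagrange interpolation operator `I_h w = ∑_z w(z) ψ_z`; the sum is over the nodes in `Ω`,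
since functions of `H¹₀(Ω)` vanish at the nodes on the boundary. -/
def interp {d : ℕ} (T : Triangulation d) (p : ℕ) : (E d → ℝ) →ₗ[ℝ] (E d → ℝ) where
  toFun w := ∑ z ∈ (nodes T p).filter (fun z => z ∈ T.domain), w z • nodalBasis T p z
  map_add' u v := by simp [add_smul, Finset.sum_add_distrib]
  map_smul' c u := by simp [mul_smul, Finset.smul_sum]

/-- The overlapping decomposition: subdomains `ω i` covering `Ω`, oversampling domains
`ωs i ⊇ ω i`, all resolved by the mesh, and a continuous partition of unity `χ` on `Ω` subordinate
to the `ω i`. -/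
structure Decomposition {d : ℕ} (T : Triangulation d) (M : ℕ) where
  ω : Fin M → Set (E d)
  ωs : Fin M → Set (E d)
  χ : Fin M → E d → ℝ
  resolves_ω : ∀ i, T.Resolves (ω i)
  resolves_ωs : ∀ i, T.Resolves (ωs i)
  subset : ∀ i, ω i ⊆ ωs i
  cover : T.domain = ⋃ i, ω i
  χ_cont : ∀ i, ContinuousOn (χ i) T.domain
  χ_supp : ∀ i, ∀ x ∈ T.domain, x ∉ closure (ω i) → χ i x = 0
  χ_mem : ∀ i, ∀ x ∈ T.domain, 0 ≤ χ i x ∧ χ i x ≤ 1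
  χ_sum : ∀ x ∈ T.domain, ∑ i, χ i x = 1

/-- The maximal number of sets of the family `U` that contain a given point of `Ω`. -/
def overlap {d M : ℕ} (Ω : Set (E d)) (U : Fin M → Set (E d)) : ℕ :=
  sSup ((fun x => {i | x ∈ U i}.ncard) '' Ω)

section Method

variable {d M : ℕ} (T : Triangulation d) (p : ℕ) (A : E d → Matrix (Fin d) (Fin d) ℝ)
  (D : Decomposition T M)

/-- The partition of unity operator `χ_{h,i} v = I_h (χ_i v)` for `v ∈ V_h(ω_i)`. -/
def pou (i : Fin M) : (E d → ℝ) →ₗ[ℝ] (E d → ℝ) where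
  toFun v := interp T p (D.χ i * v)
  map_add' u v := by rw [mul_add, map_add]
  map_smul' c u := by rw [mul_smul_comm, map_smul]; rfl

/-- `(l, φ)` solves the local eigenproblem on `V_{h,A}(ω_i^*)`:
`a_{ω_i}(χ_{h,i}(φ|_{ω_i}), χ_{h,i}(v|_{ω_i})) = l a_{ω_i^*}(φ, v)` for all `v ∈ V_{h,A}(ω_i^*)`.
For `l = ∞` this means that `a_{ω_i^*}(φ, v) = 0` for all `v ∈ V_{h,A}(ω_i^*)`. -/
def IsEigenpair (i : Fin M) (l : ℝ≥0∞) (φ : E d → ℝ) : Prop :=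
  φ ∈ harmonicSpace T p A (D.ωs i) ∧ φ ≠ 0 ∧
  ∀ v ∈ harmonicSpace T p A (D.ωs i),
    if l = ∞ then energyForm A (D.ωs i) φ v = 0
    else energyForm A (D.ω i) (pou T p D i (restr (D.ω i) φ)) (pou T p D i (restr (D.ω i) v)) =
      l.toReal * energyForm A (D.ωs i) φ v

/-- `φ 0, φ 1, …` is a complete system of eigenfunctions of the `i`-th local eigenproblem (a basis
of `V_{h,A}(ω_i^*)`, so that multiplicities are counted), with the eigenvalues `l 0 ≥ l 1 ≥ …`. -/
structure IsEigenSystem (i : Fin M) {N : ℕ} (l : Fin N → ℝ≥0∞) (φ : Fin N → E d → ℝ) : Prop where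
  linearIndependent : LinearIndependent ℝ φ
  span_eq : (Submodule.span ℝ (Set.range φ) : Set (E d → ℝ)) = harmonicSpace T p A (D.ωs i)
  eigenpair : ∀ j, IsEigenpair T p A D i (l j) (φ j)
  antitone : Antitone l

/-- The local approximation space `S_{m_i}(ω_i)`, spanned by the restrictions to `ω_i` of the first
`m` eigenfunctions. -/
def localApprox (i : Fin M) {N : ℕ} (φ : Fin N → E d → ℝ) (m : ℕ) : Submodule ℝ (E d → ℝ) :=
  Submodule.span ℝ {f | ∃ j : Fin N, (j : ℕ) < m ∧ f = restr (D.ω i) (φ j)}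

/-- The global approximation space
`S_m(Ω) = {∑_i χ_{h,i}(f_i) : f_i ∈ S_{m_i}(ω_i)}`. -/
def globalApprox {N : Fin M → ℕ} (φ : (i : Fin M) → Fin (N i) → E d → ℝ) (m : Fin M → ℕ) :
    Set (E d → ℝ) :=
  {g | ∃ f : Fin M → E d → ℝ, (∀ i, f i ∈ localApprox T D i (φ i) (m i)) ∧
    g = ∑ i, pou T p D i (f i)}

/-- The `a`-orthogonal projection onto the subspace `W` of `V_{h,0}(ω)`: the unique `w ∈ W` with
`a_ω(w, z) = a(v, z)` for all `z ∈ W`. -/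
def aProj (ω : Set (E d)) (W : Set (E d → ℝ)) (v : E d → ℝ) : E d → ℝ :=
  Classical.epsilon fun w : E d → ℝ =>
    w ∈ W ∧ ∀ z ∈ W, energyForm A ω w z = energyForm A T.domain v z

/-- `∑_i χ̃_{h,i} π_i v`, where `π_i` is the projection onto `V_{h,0}(ω_i^*)` and
`χ̃_{h,i} w = χ_{h,i}(w|_{ω_i})`. -/
def localSolves (v : E d → ℝ) : E d → ℝ :=
  ∑ i, pou T p D i (restr (D.ω i) (aProj T A (D.ωs i) (localSpaceZero T p (D.ωs i)) v))

/-- The MS-GFEM map `G(v) = ∑_i χ̃_{h,i} π_i v + π_S (v - ∑_i χ̃_{h,i} π_i v)`, where `π_S` is the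
`a`-orthogonal projection onto `S_m(Ω)`. -/
def msgfemMap {N : Fin M → ℕ} (φ : (i : Fin M) → Fin (N i) → E d → ℝ) (m : Fin M → ℕ)
    (v : E d → ℝ) : E d → ℝ :=
  localSolves T p A D v +
    aProj T A T.domain (globalApprox T p D φ m) (v - localSolves T p A D v)

end Method

/-- The first eigenvalue (in decreasing order) after the first `m` ones; it is `0` if there are no
more than `m` eigenvalues. -/
def nextEigenvalue {N : ℕ} (l : Fin N → ℝ≥0∞) (m : ℕ) : ℝ≥0∞ :=
  if h : m < N then l ⟨m, h⟩ else 0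

/-- The error bound `Λ = (ξ ξ^* max_i λ_{i, m_i + 1})^{1/2}`, in `[0, ∞]`. -/
def errorBound {d M : ℕ} {T : Triangulation d} (D : Decomposition T M) {N : Fin M → ℕ}
    (l : (i : Fin M) → Fin (N i) → ℝ≥0∞) (m : Fin M → ℕ) : ℝ≥0∞ :=
  ((overlap T.domain D.ω : ℝ≥0∞) * (overlap T.domain D.ωs : ℝ≥0∞) *
    ⨆ i, nextEigenvalue (l i) (m i)) ^ (1 / 2 : ℝ)

end

end MSGFEM

/-! With e = u_h - v^j, one step of the iteration replaces e by e - G(e). Put w_i = π_i e.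
Interpolation is the identity on V_h, so the operators χ_{h,i} sum to the identity there. Hence g =
e - ∑ χ_{h,i} w_i equals ∑ χ_{h,i}(e - w_i), and e - G(e) = g - π_S g. The projection is the best
approximation, so g may be compared with any s = ∑ χ_{h,i} f_i in S_m(Ω).

On ω_i^* the function e - w_i is a-harmonic, so it is a combination of the local eigenfunctions. Let
μ be the maximum over i of the first discarded eigenvalues. Take for f_i the part that belongs to
eigenvalues above μ; these all come among the first m_i. By `spectral_truncation_le` the image of
the remainder under χ_{h,i} has energy at most μ times that of e - w_i, which is at most μ
a_{ω_i^*}(e, e) because w_i is a projection. At almost every point at most ξ of the local remainders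
have a nonzero gradient, which gives the factor ξ (`energyForm_sum_le`). Summing the energies of e
over the ω_i^* gives ξ^* (`sum_energyForm_le`). `energyForm_sub_msgfemMap_le` puts this together.

The nodal basis and the projections are specified by choice, so they must be shown to exist. The
basis comes from gluing explicit Lagrange functions over a conforming mesh, together with
unisolvence on each simplex. The projections come from definiteness of the energy form on the
finite-dimensional V_h. -/

namespace MSGFEM

noncomputable section

variable {d : ℕ}

/-! ### Barycentric coordinates and conformity -/

/-- The vertex sets of nondegenerate `d`-simplices. -/
structure IsSimplex (s : Finset (E d)) : Prop where
  card_eq : s.card = d + 1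
  indep : AffineIndependent ℝ ((↑) : s → E d)

theorem Triangulation.isSimplex (T : Triangulation d) {s : Finset (E d)} (hs : s ∈ T.elements) :
    IsSimplex s :=
  ⟨T.card_eq s hs, T.indep s hs⟩

/-- The vertices of a nondegenerate `d`-simplex form an affine basis. -/
def IsSimplex.basis {s : Finset (E d)} (h : IsSimplex s) : AffineBasis s ℝ (E d) where
  toFun := (↑)
  ind' := h.indep
  tot' := by
    rw [h.indep.affineSpan_eq_top_iff_card_eq_finrank_add_one]
    simp [h.card_eq]

theorem IsSimplex.basis_apply {s : Finset (E d)} (h : IsSimplex s) (v : s) :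
    h.basis v = (v : E d) := rfl

open Classical in
/-- The barycentric coordinate of the vertex `v` of `s`, zero if `v` is not a vertex of `s`. -/
def bary (s : Finset (E d)) (v : E d) : E d →ᵃ[ℝ] ℝ :=
  if h : IsSimplex s ∧ v ∈ s then h.1.basis.coord ⟨v, h.2⟩ else 0

theorem bary_of_notMem {s : Finset (E d)} {v : E d} (hv : v ∉ s) (x : E d) : bary s v x = 0 := by
  simp [bary, hv]

theorem mem_of_bary_ne_zero {s : Finset (E d)} {v x : E d} (h : bary s v x ≠ 0) : v ∈ s := by
  by_contra hv
  exact h (bary_of_notMem hv x)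

theorem IsSimplex.bary_eq {s : Finset (E d)} (h : IsSimplex s) (v : s) (x : E d) :
    bary s v x = h.basis.coord v x := by
  simp [bary, h]

theorem continuous_bary (s : Finset (E d)) (v : E d) : Continuous (bary s v) :=
  (bary s v).continuous_of_finiteDimensional

theorem IsSimplex.sum_bary {s : Finset (E d)} (h : IsSimplex s) (x : E d) :
    ∑ v ∈ s, bary s v x = 1 := by
  rw [← Finset.sum_coe_sort]
  simp only [h.bary_eq]
  exact h.basis.sum_coord_apply_eq_one x

theorem IsSimplex.sum_bary_smul {s : Finset (E d)} (h : IsSimplex s) (x : E d) :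
    ∑ v ∈ s, bary s v x • v = x := by
  rw [← Finset.sum_coe_sort s (fun v => bary s v x • v)]
  simp only [h.bary_eq]
  exact h.basis.linear_combination_coord_eq_self x

theorem IsSimplex.bary_combination {s : Finset (E d)} (h : IsSimplex s) {w : E d → ℝ}
    (hw : ∑ v ∈ s, w v = 1) {v : E d} (hv : v ∈ s) :
    bary s v (∑ u ∈ s, w u • u) = w v := by
  have hw' : ∑ u : s, w u = 1 := by rw [Finset.sum_coe_sort]; exact hw
  have := h.basis.coord_apply_combination_of_mem (Finset.mem_univ ⟨v, hv⟩) hw'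
  rw [Finset.affineCombination_eq_linear_combination _ _ _ hw'] at this
  rw [h.bary_eq ⟨v, hv⟩, ← Finset.sum_coe_sort s (fun u => w u • u)]
  exact this

theorem IsSimplex.range_basis {s : Finset (E d)} (h : IsSimplex s) :
    Set.range h.basis = (s : Set (E d)) := by
  ext x
  simp [h.basis_apply]

theorem IsSimplex.mem_convexHull_iff {s : Finset (E d)} (h : IsSimplex s) {x : E d} :
    x ∈ convexHull ℝ (s : Set (E d)) ↔ ∀ v, 0 ≤ bary s v x := by
  rw [← h.range_basis, h.basis.convexHull_eq_nonneg_coord]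
  constructor
  · intro hx v
    by_cases hv : v ∈ s
    · rw [h.bary_eq ⟨v, hv⟩]; exact hx _
    · rw [bary_of_notMem hv]
  · intro hx v
    rw [← h.bary_eq]
    exact hx _

theorem IsSimplex.mem_interior_iff {s : Finset (E d)} (h : IsSimplex s) {x : E d} :
    x ∈ interior (convexHull ℝ (s : Set (E d))) ↔ ∀ v ∈ s, 0 < bary s v x := by
  rw [← h.range_basis, h.basis.interior_convexHull]
  constructor
  · intro hx v hv
    rw [h.bary_eq ⟨v, hv⟩]; exact hx _
  · intro hx v
    rw [← h.bary_eq]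
    exact hx _ v.2

open Classical in
theorem IsSimplex.bary_of_face {s r : Finset (E d)} (h : IsSimplex s) (hr : r ⊆ s)
    {w : E d → ℝ} (hw : ∑ v ∈ r, w v = 1) (v : E d) :
    bary s v (∑ u ∈ r, w u • u) = if v ∈ r then w v else 0 := by
  have hsub : ∀ {F : Type} [AddCommMonoid F] (f : E d → F),
      ∑ u ∈ s, (if u ∈ r then f u else 0) = ∑ u ∈ r, f u := by
    intro F _ f
    rw [← Finset.sum_filter, Finset.filter_mem_eq_inter, Finset.inter_eq_right.2 hr]
  by_cases hv : v ∈ s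
  · have h1 : ∑ u ∈ s, (if u ∈ r then w u else 0) = 1 := by rw [hsub, hw]
    have h2 : ∑ u ∈ r, w u • u = ∑ u ∈ s, (if u ∈ r then w u else 0) • u := by
      rw [← Finset.sum_subset hr]
      · exact Finset.sum_congr rfl fun u hu => by rw [if_pos hu]
      · intro u _ hu; rw [if_neg hu, zero_smul]
    rw [h2, h.bary_combination (w := fun u => if u ∈ r then w u else 0) h1 hv]
  · rw [bary_of_notMem hv, if_neg fun hvr => hv (hr hvr)]

/-- Conformity writes a common point as a convex combination of common vertices, and its weights are
the coordinates in both simplices. Everything that is glued across elements rests on this. -/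
theorem Triangulation.bary_eq_bary (T : Triangulation d) {s t : Finset (E d)}
    (hs : s ∈ T.elements) (ht : t ∈ T.elements) {x : E d}
    (hxs : x ∈ convexHull ℝ (s : Set (E d))) (hxt : x ∈ convexHull ℝ (t : Set (E d))) (v : E d) :
    bary s v x = bary t v x := by
  classical
  have hx : x ∈ convexHull ℝ ((s ∩ t : Finset (E d)) : Set (E d)) := by
    rw [Finset.coe_inter, ← T.conforming s hs t ht]
    exact ⟨hxs, hxt⟩
  rw [Finset.mem_convexHull'] at hx
  obtain ⟨w, -, hw1, rfl⟩ := hx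
  rw [(T.isSimplex hs).bary_of_face Finset.inter_subset_left hw1,
    (T.isSimplex ht).bary_of_face Finset.inter_subset_right hw1]

theorem IsSimplex.mem_convexHull_of_bary {s : Finset (E d)} (h : IsSimplex s) {x : E d}
    (hx : x ∈ convexHull ℝ (s : Set (E d))) {t : Finset (E d)}
    (ht : ∀ v, bary s v x ≠ 0 → v ∈ t) : x ∈ convexHull ℝ (t : Set (E d)) := by
  classical
  have hsub : ∀ {F : Type} [AddCommMonoid F] (f : E d → F),
      (∀ u ∈ s, u ∉ t → f u = 0) → ∑ u ∈ s ∩ t, f u = ∑ u ∈ s, f u := by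
    intro F _ f hf
    refine Finset.sum_subset Finset.inter_subset_left fun u hu hut => hf u hu fun hut' => ?_
    exact hut (Finset.mem_inter.2 ⟨hu, hut'⟩)
  have hz : ∀ u, u ∉ t → bary s u x = 0 := fun u hu => by
    by_contra hne
    exact hu (ht u hne)
  refine convexHull_mono (s := ((s ∩ t : Finset (E d)) : Set (E d)))
    (by rw [Finset.coe_inter]; exact Set.inter_subset_right) ?_
  rw [Finset.mem_convexHull']
  refine ⟨fun v => bary s v x, fun v _ => h.mem_convexHull_iff.1 hx v, ?_, ?_⟩
  · rw [hsub _ fun u _ hu => hz u hu, h.sum_bary]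
  · rw [hsub (fun u => bary s u x • u) fun u _ hu => by rw [hz u hu, zero_smul], h.sum_bary_smul]

/-! ### Lagrange functions and unisolvence on a simplex -/

/-- An affine function is a polynomial of degree at most one. -/
theorem exists_polynomial_of_affineMap (f : E d →ᵃ[ℝ] ℝ) :
    ∃ q : MvPolynomial (Fin d) ℝ, q.totalDegree ≤ 1 ∧
      ∀ x : E d, MvPolynomial.eval x.ofLp q = f x := by
  refine ⟨MvPolynomial.C (f 0) + ∑ i, MvPolynomial.C (f.linear (EuclideanSpace.single i 1)) *
    MvPolynomial.X i, ?_, fun x => ?_⟩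
  · refine (MvPolynomial.totalDegree_add _ _).trans (max_le (by simp) ?_)
    refine MvPolynomial.totalDegree_finsetSum_le fun i _ => ?_
    refine (MvPolynomial.totalDegree_mul _ _).trans ?_
    simp [MvPolynomial.totalDegree_X]
  · have hx : x = ∑ i, x i • EuclideanSpace.single i (1 : ℝ) := by
      ext j
      simp [Finset.sum_apply, Pi.single_apply]
    have hf : f x = f.linear x + f 0 := by
      conv_lhs => rw [f.decomp]
      rfl
    rw [hf]
    conv_rhs => rw [hx]
    simp only [map_add, MvPolynomial.eval_C, map_sum, map_mul, MvPolynomial.eval_X, map_smul,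
      smul_eq_mul]
    rw [add_comm]
    congr 1
    exact Finset.sum_congr rfl fun i _ => mul_comm _ _

/-- On the simplex `s`, the Lagrange function of the node with the barycentric coordinates `α / p`
with respect to `s₀`. -/
def lagrange (p : ℕ) (s₀ : Finset (E d)) (α : E d → ℕ) (s : Finset (E d)) (x : E d) : ℝ :=
  ∏ v ∈ s₀, ∏ k ∈ Finset.range (α v), (p * bary s v x - k) / ((α v : ℝ) - k)

theorem continuous_lagrange (p : ℕ) (s₀ : Finset (E d)) (α : E d → ℕ) (s : Finset (E d)) :
    Continuous (lagrange p s₀ α s) := by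
  refine continuous_finsetProd _ fun v _ => continuous_finsetProd _ fun k _ => ?_
  exact ((continuous_const.mul (continuous_bary s v)).sub continuous_const).div_const _

theorem exists_polynomial_lagrange {p : ℕ} {s₀ : Finset (E d)} {α : E d → ℕ}
    (hα : ∑ v ∈ s₀, α v = p) (s : Finset (E d)) :
    ∃ q : MvPolynomial (Fin d) ℝ, q.totalDegree ≤ p ∧
      ∀ x : E d, MvPolynomial.eval x.ofLp q = lagrange p s₀ α s x := by
  choose b hb hbe using fun v : E d => exists_polynomial_of_affineMap (bary s v)
  refine ⟨∏ v ∈ s₀, ∏ k ∈ Finset.range (α v), MvPolynomial.C ((α v : ℝ) - k)⁻¹ *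
    (MvPolynomial.C (p : ℝ) * b v - MvPolynomial.C (k : ℝ)), ?_, fun x => ?_⟩
  · rw [← hα]
    refine (MvPolynomial.totalDegree_finsetProd _ _).trans (Finset.sum_le_sum fun v _ => ?_)
    refine (MvPolynomial.totalDegree_finsetProd _ _).trans ?_
    refine (Finset.sum_le_card_nsmul _ _ 1 fun k _ => ?_).trans (by simp)
    refine (MvPolynomial.totalDegree_mul _ _).trans ?_
    rw [MvPolynomial.totalDegree_C, zero_add]
    refine (MvPolynomial.totalDegree_sub _ _).trans (max_le ?_
      (by rw [MvPolynomial.totalDegree_C]; exact zero_le_one))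
    refine (MvPolynomial.totalDegree_mul _ _).trans ?_
    rw [MvPolynomial.totalDegree_C, zero_add]
    exact hb v
  · simp only [map_prod, map_mul, map_sub, MvPolynomial.eval_C, hbe, lagrange]
    refine Finset.prod_congr rfl fun v _ => Finset.prod_congr rfl fun k _ => ?_
    rw [div_eq_mul_inv, mul_comm]

theorem lagrange_ne_zero {p : ℕ} {s₀ : Finset (E d)} {α : E d → ℕ} {s : Finset (E d)} {x : E d}
    (hx : lagrange p s₀ α s x ≠ 0) {v : E d} (hv : v ∈ s₀) (hα : α v ≠ 0) :
    bary s v x ≠ 0 := by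
  intro h0
  refine hx (Finset.prod_eq_zero hv (Finset.prod_eq_zero
    (Finset.mem_range.2 (Nat.pos_of_ne_zero hα)) ?_))
  simp [h0]

theorem lagrange_self {p : ℕ} {s₀ : Finset (E d)} {α : E d → ℕ} {s : Finset (E d)} {x : E d}
    (hx : ∀ v ∈ s₀, p * bary s v x = α v) : lagrange p s₀ α s x = 1 := by
  refine Finset.prod_eq_one fun v hv => Finset.prod_eq_one fun k hk => ?_
  rw [hx v hv]
  refine div_self (sub_ne_zero.2 ?_)
  exact_mod_cast (Finset.mem_range.1 hk).ne'

theorem lagrange_eq_zero {p : ℕ} {s₀ : Finset (E d)} {α β : E d → ℕ} {s : Finset (E d)} {x : E d}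
    {v : E d} (hv : v ∈ s₀) (hx : p * bary s v x = β v) (hlt : β v < α v) :
    lagrange p s₀ α s x = 0 := by
  refine Finset.prod_eq_zero hv (Finset.prod_eq_zero (Finset.mem_range.2 hlt) ?_)
  simp [hx]

/-- The point with barycentric coordinates `α / p`. -/
def latticePoint (p : ℕ) (s : Finset (E d)) (α : E d → ℕ) : E d :=
  ∑ v ∈ s, ((α v : ℝ) / (p : ℝ)) • v

theorem sum_div_eq_one {p : ℕ} (hp : 1 ≤ p) {s : Finset (E d)} {α : E d → ℕ}
    (hα : ∑ v ∈ s, α v = p) : ∑ v ∈ s, (α v : ℝ) / (p : ℝ) = 1 := by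
  have hp' : (p : ℝ) ≠ 0 := by positivity
  rw [← Finset.sum_div, div_eq_one_iff_eq hp']
  exact_mod_cast hα

theorem IsSimplex.bary_latticePoint {p : ℕ} (hp : 1 ≤ p) {s : Finset (E d)} (h : IsSimplex s)
    {α : E d → ℕ} (hα : ∑ v ∈ s, α v = p) (hs : ∀ v, α v ≠ 0 → v ∈ s) (v : E d) :
    p * bary s v (latticePoint p s α) = α v := by
  have hp' : (p : ℝ) ≠ 0 := by positivity
  by_cases hv : v ∈ s
  · rw [latticePoint, h.bary_combination (sum_div_eq_one hp hα) hv, mul_div_cancel₀ _ hp']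
  · have : α v = 0 := by
      by_contra hne
      exact hv (hs v hne)
    rw [bary_of_notMem hv, this]
    simp

theorem latticePoint_mem_convexHull {p : ℕ} (hp : 1 ≤ p) {s : Finset (E d)}
    {α : E d → ℕ} (hα : ∑ v ∈ s, α v = p) :
    latticePoint p s α ∈ convexHull ℝ (s : Set (E d)) := by
  rw [Finset.mem_convexHull']
  exact ⟨_, fun v _ => by positivity, sum_div_eq_one hp hα, rfl⟩

-- Homogenisation: an exponent tuple of degree at most p is completed by the slack p - |n|, placed
-- at the one additional vertex.
open Classical in
theorem card_degree_le_card_piAntidiag {s : Finset (E d)} (hs : s.card = d + 1) (p : ℕ) :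
    Nat.card {n : Fin d →₀ ℕ | (n.sum fun _ e => e) ≤ p} ≤ (s.piAntidiag p).card := by
  have e : Option (Fin d) ≃ s := Fintype.equivOfCardEq (by simp [hs])
  let w : (Fin d →₀ ℕ) → Option (Fin d) → ℕ := fun n o => o.elim (p - n.sum fun _ e => e) n
  let f : (Fin d →₀ ℕ) → E d → ℕ := fun n v => if h : v ∈ s then w n (e.symm ⟨v, h⟩) else 0
  have hfe : ∀ n o, f n (e o) = w n o := fun n o => by simp [f]
  have hmem : ∀ n : {n : Fin d →₀ ℕ | (n.sum fun _ e => e) ≤ p}, f n ∈ s.piAntidiag p := by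
    rintro ⟨n, hn⟩
    rw [Finset.mem_piAntidiag]
    refine ⟨?_, fun v hv => ?_⟩
    · rw [← Finset.sum_coe_sort s (f n), ← e.sum_comp]
      simp only [hfe, Fintype.sum_option, w, Option.elim]
      rw [Set.mem_ofPred_eq, Finsupp.sum_fintype _ _ fun _ => rfl] at hn
      rw [Finsupp.sum_fintype _ _ fun _ => rfl]
      omega
    · by_contra hvs
      simp [f, hvs] at hv
  rw [← Nat.card_eq_finsetCard]
  refine Nat.card_le_card_of_injective (fun n => (⟨f n, hmem n⟩ : s.piAntidiag p)) ?_
  rintro ⟨n, hn⟩ ⟨n', hn'⟩ hnn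
  have hff : f n = f n' := congrArg Subtype.val hnn
  refine Subtype.ext (Finsupp.ext fun i => ?_)
  have := congrFun hff (e (some i))
  rwa [hfe, hfe] at this

/-- Unisolvence: a polynomial of degree at most `p` is determined by its values at the points of
the simplex with barycentric coordinates in `ℤ / p`. -/
theorem IsSimplex.eq_zero_of_eval_latticePoint {p : ℕ} (hp : 1 ≤ p) {s : Finset (E d)}
    (h : IsSimplex s) {q : MvPolynomial (Fin d) ℝ} (hq : q.totalDegree ≤ p)
    (h0 : ∀ α : E d → ℕ, ∑ v ∈ s, α v = p → (∀ v, α v ≠ 0 → v ∈ s) →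
      MvPolynomial.eval (latticePoint p s α).ofLp q = 0) : q = 0 := by
  classical
  let ev : MvPolynomial.restrictTotalDegree (Fin d) ℝ p →ₗ[ℝ] (s.piAntidiag p → ℝ) :=
    LinearMap.pi fun α => (MvPolynomial.aeval (latticePoint p s α).ofLp).toLinearMap ∘ₗ
      Submodule.subtype _
  have hev : ∀ r α, ev r α = MvPolynomial.eval (latticePoint p s α).ofLp r.1 := fun r α => by
    simp [ev, MvPolynomial.aeval_eq_eval]
  have hα : ∀ α : s.piAntidiag p, ∑ v ∈ s, α.1 v = p ∧ ∀ v, α.1 v ≠ 0 → v ∈ s := fun α =>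
    Finset.mem_piAntidiag.1 α.2
  choose L hL hLe using fun α : s.piAntidiag p => exists_polynomial_lagrange (hα α).1 s
  have hLev : ∀ α β, ev ⟨L α, (MvPolynomial.mem_restrictTotalDegree _ _ _).2 (hL α)⟩ β =
      if β = α then 1 else 0 := by
    intro α β
    rw [hev, hLe]
    have hb := h.bary_latticePoint hp (hα β).1 (hα β).2
    split_ifs with hαβ
    · subst hαβ
      exact lagrange_self fun v _ => hb v
    -- Distinct tuples with the same sum: α cannot lie below β everywhere, so some factor of the
    -- Lagrange product vanishes.
    · obtain ⟨v, hv, hlt⟩ : ∃ v ∈ s, β.1 v < α.1 v := by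
        by_contra! hle
        refine hαβ (Subtype.ext (funext fun v => ?_))
        by_cases hv : v ∈ s
        · exact (((Finset.sum_eq_sum_iff_of_le hle).1 ((hα α).1.trans (hα β).1.symm)) v hv).symm
        · rw [not_not.1 fun hne => hv ((hα α).2 v hne), not_not.1 fun hne => hv ((hα β).2 v hne)]
      exact lagrange_eq_zero hv (hb v) hlt
  have hsurj : Function.Surjective ev := by
    intro c
    refine ⟨∑ α, c α • ⟨L α, (MvPolynomial.mem_restrictTotalDegree _ _ _).2 (hL α)⟩, ?_⟩
    ext β
    rw [map_sum, Finset.sum_apply]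
    simp only [map_smul, Pi.smul_apply, hLev]
    simp
  -- The dual family makes evaluation surjective; counting monomials bounds the dimension of the
  -- source by the number of lattice points. So evaluation is also injective.
  have hfin : Module.finrank ℝ (MvPolynomial.restrictTotalDegree (Fin d) ℝ p) =
      Module.finrank ℝ (s.piAntidiag p → ℝ) := by
    refine le_antisymm ?_ (LinearMap.finrank_le_finrank_of_surjective hsurj)
    refine (Module.finrank_eq_nat_card_basis (MvPolynomial.basisRestrictSupport ℝ
      {n : Fin d →₀ ℕ | (n.sum fun _ e => e) ≤ p})).le.trans ?_
    simpa using card_degree_le_card_piAntidiag h.card_eq p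
  have hinj := (LinearMap.injective_iff_surjective_of_finrank_eq_finrank hfin).2 hsurj
  have hq0 : (⟨q, (MvPolynomial.mem_restrictTotalDegree _ _ _).2 hq⟩ :
      MvPolynomial.restrictTotalDegree (Fin d) ℝ p) = 0 := by
    refine hinj ?_
    ext α
    rw [hev, map_zero, h0 α.1 (hα α).1 (hα α).2]
    rfl
  exact congrArg Subtype.val hq0

/-! ### Nodal basis and Lagrange interpolation -/

theorem isClosed_region (S : Finset (Finset (E d))) : IsClosed (region S) :=
  S.finite_toSet.isClosed_biUnion fun s _ => (s.finite_toSet.isCompact_convexHull ℝ).isClosed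

theorem isClosed_convexHull (s : Finset (E d)) : IsClosed (convexHull ℝ (s : Set (E d))) :=
  (s.finite_toSet.isCompact_convexHull ℝ).isClosed

theorem mem_region {S : Finset (Finset (E d))} {x : E d} :
    x ∈ region S ↔ ∃ s ∈ S, x ∈ convexHull ℝ (s : Set (E d)) := by
  simp [region]

/-- If `z` is an interior point of the mesh region, then so is every point of the region whose
barycentric coordinates are positive whenever those of `z` are. -/
theorem Triangulation.mem_domain_of_bary (T : Triangulation d) {s : Finset (E d)}
    (hs : s ∈ T.elements) {z x : E d} (hz : z ∈ T.domain)
    (hzs : z ∈ convexHull ℝ (s : Set (E d))) (hxs : x ∈ convexHull ℝ (s : Set (E d)))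
    (hzx : ∀ v, bary s v z ≠ 0 → bary s v x ≠ 0) : x ∈ T.domain := by
  have hS := T.isSimplex hs
  -- a point `z + θ (x - z)` in the domain with `0 < θ`
  have hline : Filter.Tendsto (fun θ : ℝ => AffineMap.lineMap z x θ) (nhdsWithin 0 (Set.Ioo 0 1))
      (nhds z) := by
    have : Continuous fun θ : ℝ => AffineMap.lineMap z x θ := AffineMap.lineMap_continuous
    have h0 := (this.tendsto 0).mono_left (nhdsWithin_le_nhds (s := Set.Ioo (0 : ℝ) 1))
    simpa using h0
  have hne : (nhdsWithin (0 : ℝ) (Set.Ioo 0 1)).NeBot :=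
    left_nhdsWithin_Ioo_neBot one_pos
  obtain ⟨θ, hθΩ, hθ0, hθ1⟩ := ((hline.eventually (isOpen_interior.mem_nhds hz)).and
    self_mem_nhdsWithin).exists
  have hθb : ∀ (t : Finset (E d)) (v y : E d), bary t v (AffineMap.lineMap z y θ) =
      (1 - θ) * bary t v z + θ * bary t v y := fun t v y => by
    rw [AffineMap.apply_lineMap, AffineMap.lineMap_apply_ring]
  set xθ : E d := AffineMap.lineMap z x θ with hxθ
  have hxθs : xθ ∈ convexHull ℝ (s : Set (E d)) :=
    (convex_convexHull ℝ _).lineMap_mem hzs hxs ⟨hθ0.le, hθ1.le⟩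
  -- elements which contain `xθ` contain `x`
  have hface : ∀ t ∈ T.elements, xθ ∈ convexHull ℝ (t : Set (E d)) →
      (x ∈ convexHull ℝ (t : Set (E d)) ∧ z ∈ convexHull ℝ (t : Set (E d))) := by
    intro t ht hxt
    have key : ∀ v, bary s v x ≠ 0 → v ∈ t := by
      intro v hv
      have hpos : 0 < bary s v xθ := by
        rw [hxθ, hθb]
        have h1 := hS.mem_convexHull_iff.1 hzs v
        have h2 := lt_of_le_of_ne (hS.mem_convexHull_iff.1 hxs v) hv.symm
        have h3 : 0 ≤ 1 - θ := by linarith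
        positivity
      refine mem_of_bary_ne_zero (s := t) (x := xθ) ?_
      rw [← T.bary_eq_bary hs ht hxθs hxt]
      exact hpos.ne'
    exact ⟨hS.mem_convexHull_of_bary hxs key, hS.mem_convexHull_of_bary hzs fun v hv =>
      key v (hzx v hv)⟩
  rw [Triangulation.domain, mem_interior_iff_mem_nhds]
  -- The contraction towards z with ratio θ moves points near x to points near `xθ`, which lie in
  -- the region. Near `xθ` only elements containing `xθ` occur, and these contain x and z.
  have hcont : Filter.Tendsto (fun y : E d => AffineMap.lineMap z y θ) (nhds x) (nhds xθ) := by
    have : Continuous fun y : E d => AffineMap.lineMap z y θ := by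
      simp only [AffineMap.lineMap_apply_module]
      fun_prop
    exact this.tendsto x
  have h1 : ∀ᶠ y in nhds x, AffineMap.lineMap z y θ ∈ region T.elements :=
    (hcont.eventually (isOpen_interior.mem_nhds hθΩ)).mono fun y hy => interior_subset hy
  have h2 : ∀ᶠ y in nhds x, ∀ t ∈ T.elements, xθ ∉ convexHull ℝ (t : Set (E d)) →
      AffineMap.lineMap z y θ ∉ convexHull ℝ (t : Set (E d)) := by
    rw [Filter.eventually_all_finset]
    intro t _
    by_cases hxt : xθ ∈ convexHull ℝ (t : Set (E d))
    · exact Filter.Eventually.of_forall fun y h => absurd hxt h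
    · exact (hcont.eventually ((isClosed_convexHull t).isOpen_compl.mem_nhds hxt)).mono
        fun y hy _ => hy
  have h3 : ∀ᶠ y in nhds x, ∀ t ∈ T.elements, ∀ v ∈ t, 0 < bary t v x → 0 < bary t v y := by
    rw [Filter.eventually_all_finset]
    intro t _
    rw [Filter.eventually_all_finset]
    intro v _
    by_cases hv : 0 < bary t v x
    · exact ((continuous_bary t v).tendsto x |>.eventually (lt_mem_nhds hv)).mono fun y hy _ => hy
    · exact Filter.Eventually.of_forall fun y h => absurd h hv
  filter_upwards [h1, h2, h3] with y hy1 hy2 hy3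
  obtain ⟨t, ht, hyt⟩ := mem_region.1 hy1
  have hxt : xθ ∈ convexHull ℝ (t : Set (E d)) := by
    by_contra hxt
    exact hy2 t ht hxt hyt
  obtain ⟨hxt', hzt⟩ := hface t ht hxt
  refine mem_region.2 ⟨t, ht, (T.isSimplex ht).mem_convexHull_iff.2 fun v => ?_⟩
  by_cases hv : v ∈ t
  -- A coordinate that is zero at x is zero at z too, so at the contracted point it is θ times its
  -- value at y. A coordinate positive at x stays positive nearby.
  · by_cases hx0 : bary t v x = 0
    · have hz0 : bary t v z = 0 := by
        by_contra hz0
        rw [← T.bary_eq_bary hs ht hzs hzt] at hz0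
        rw [← T.bary_eq_bary hs ht hxs hxt'] at hx0
        exact hzx v hz0 hx0
      have := (T.isSimplex ht).mem_convexHull_iff.1 hyt v
      rw [hθb, hz0, mul_zero, zero_add] at this
      exact nonneg_of_mul_nonneg_right this hθ0
    · exact (hy3 t ht v hv (lt_of_le_of_ne ((T.isSimplex ht).mem_convexHull_iff.1 hxt' v)
        (Ne.symm hx0))).le
  · rw [bary_of_notMem hv]

variable {T : Triangulation d} {p : ℕ}

theorem Triangulation.domain_subset (T : Triangulation d) : T.domain ⊆ region T.elements :=
  interior_subset

open Classical in
theorem mem_nodes {y : E d} : y ∈ nodes T p ↔ ∃ s ∈ T.elements, ∃ α : E d → ℕ,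
    ∑ v ∈ s, α v = p ∧ (∀ v, α v ≠ 0 → v ∈ s) ∧ latticePoint p s α = y := by
  simp only [nodes, Finset.mem_biUnion, Finset.mem_image, Finset.mem_piAntidiag, latticePoint,
    and_assoc]

/-- Continuous functions on the elements which agree on common faces and vanish outside the domain
can be glued. -/
theorem Triangulation.exists_glue (T : Triangulation d) {f : Finset (E d) → E d → ℝ}
    (hc : ∀ s ∈ T.elements, Continuous (f s))
    (hcompat : ∀ s ∈ T.elements, ∀ t ∈ T.elements, ∀ x ∈ convexHull ℝ (s : Set (E d)),
      x ∈ convexHull ℝ (t : Set (E d)) → f s x = f t x)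
    (hzero : ∀ s ∈ T.elements, ∀ x ∈ convexHull ℝ (s : Set (E d)), x ∉ T.domain → f s x = 0) :
    ∃ F : E d → ℝ, Continuous F ∧ (∀ x, x ∉ T.domain → F x = 0) ∧
      ∀ s ∈ T.elements, ∀ x ∈ convexHull ℝ (s : Set (E d)), F x = f s x := by
  classical
  let F : E d → ℝ := fun x =>
    if h : ∃ s ∈ T.elements, x ∈ convexHull ℝ (s : Set (E d)) then f h.choose x else 0
  have hF : ∀ s ∈ T.elements, ∀ x ∈ convexHull ℝ (s : Set (E d)), F x = f s x := by
    intro s hs x hx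
    have h : ∃ s ∈ T.elements, x ∈ convexHull ℝ (s : Set (E d)) := ⟨s, hs, hx⟩
    simp only [F, dif_pos h]
    exact hcompat _ h.choose_spec.1 s hs x h.choose_spec.2 hx
  have hF0 : ∀ x, x ∉ T.domain → F x = 0 := by
    intro x hx
    by_cases h : ∃ s ∈ T.elements, x ∈ convexHull ℝ (s : Set (E d))
    · obtain ⟨s, hs, hxs⟩ := h
      rw [hF s hs x hxs, hzero s hs x hxs hx]
    · simp only [F, dif_neg h]
  refine ⟨F, ?_, hF0, hF⟩
  -- A finite closed cover of the whole space: the elements, and the complement of the domain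
  -- indexed by `none`.
  refine (locallyFinite_of_finite fun o : Option T.elements =>
    o.elim T.domainᶜ fun s => convexHull ℝ (s.1 : Set (E d))).continuous ?_ ?_ ?_
  · refine Set.eq_univ_of_forall fun x => Set.mem_iUnion.2 ?_
    by_cases hx : x ∈ T.domain
    · obtain ⟨s, hs, hxs⟩ := mem_region.1 (T.domain_subset hx)
      exact ⟨some ⟨s, hs⟩, hxs⟩
    · exact ⟨none, hx⟩
  · rintro (_ | s)
    · exact isOpen_interior.isClosed_compl
    · exact isClosed_convexHull s.1
  · rintro (_ | s)
    · exact continuousOn_const.congr fun x hx => hF0 x hx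
    · exact (hc s.1 s.2).continuousOn.congr fun x hx => hF s.1 s.2 x hx

open Classical in
theorem exists_nodal (hp : 1 ≤ p) {z : E d} (hz : z ∈ nodes T p) (hzΩ : z ∈ T.domain) :
    ∃ v ∈ feSpace T p, ∀ y ∈ nodes T p, v y = if y = z then 1 else 0 := by
  obtain ⟨s₀, hs₀, α, hα, hαs, rfl⟩ := mem_nodes.1 hz
  have hb₀ := (T.isSimplex hs₀).bary_latticePoint hp hα hαs
  have hz₀ := latticePoint_mem_convexHull hp hα
  have hp' : (p : ℝ) ≠ 0 := by positivity
  obtain ⟨F, hFc, hF0, hF⟩ := T.exists_glue (f := lagrange p s₀ α)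
    (fun s _ => continuous_lagrange _ _ _ _)
    (fun s hs t ht x hxs hxt => by
      unfold lagrange
      simp only [T.bary_eq_bary hs ht hxs hxt])
    (fun s hs x hxs hx => by
      by_contra hne
      refine hx ?_
      -- A nonzero value at x forces nonzero coordinates at x for all vertices that carry the node.
      -- Then the node lies in s too, and since it is interior to the mesh region, so is x.
      have hsupp : ∀ v, α v ≠ 0 → bary s v x ≠ 0 := fun v hv =>
        lagrange_ne_zero hne (hαs v hv) hv
      have hzs : latticePoint p s₀ α ∈ convexHull ℝ (s : Set (E d)) :=
        (T.isSimplex hs₀).mem_convexHull_of_bary hz₀ fun v hv =>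
          mem_of_bary_ne_zero (hsupp v fun h => hv (by
            have := hb₀ v
            rw [h] at this
            simpa [hp'] using this))
      refine T.mem_domain_of_bary hs hzΩ hzs hxs fun v hv => hsupp v fun h => hv ?_
      rw [T.bary_eq_bary hs hs₀ hzs hz₀]
      have := hb₀ v
      rw [h] at this
      simpa [hp'] using this)
  refine ⟨F, ⟨hFc, hF0, fun s hs => ?_⟩, fun y hy => ?_⟩
  · obtain ⟨q, hq, hqe⟩ := exists_polynomial_lagrange hα s
    exact ⟨q, hq, fun x hx => by rw [hF s hs x hx, hqe]⟩
  · obtain ⟨s, hs, β, hβ, hβs, rfl⟩ := mem_nodes.1 hy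
    have hb := (T.isSimplex hs).bary_latticePoint hp hβ hβs
    have hy := latticePoint_mem_convexHull hp hβ
    rw [hF s hs _ hy]
    split_ifs with hyz
    · refine lagrange_self fun v _ => ?_
      rw [T.bary_eq_bary hs hs₀ hy (hyz ▸ hz₀), hyz, hb₀]
    · obtain ⟨v, hv, hlt⟩ : ∃ v ∈ s₀, β v < α v := by
        by_contra! hle
        refine hyz ?_
        -- The tuples α and β live on different simplices. Extended by zero to the union of the
        -- vertex sets they have equal sums, so α ≤ β would make them equal and the nodes identical.
        have hα' : ∑ v ∈ s₀ ∪ s, α v = p := by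
          rw [← hα]
          refine (Finset.sum_subset Finset.subset_union_left fun v _ hv => ?_).symm
          exact not_not.1 fun hne => hv (hαs v hne)
        have hβ' : ∑ v ∈ s₀ ∪ s, β v = p := by
          rw [← hβ]
          refine (Finset.sum_subset Finset.subset_union_right fun v _ hv => ?_).symm
          exact not_not.1 fun hne => hv (hβs v hne)
        have hle' : ∀ v ∈ s₀ ∪ s, α v ≤ β v := fun v _ => by
          by_cases hv : v ∈ s₀
          · exact hle v hv
          · rw [not_not.1 fun hne => hv (hαs v hne)]
            exact Nat.zero_le _
        have heq := (Finset.sum_eq_sum_iff_of_le hle').1 (hα'.trans hβ'.symm)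
        have hαβ : ∀ v, α v = β v := fun v => by
          by_cases hv : v ∈ s₀ ∪ s
          · exact heq v hv
          · rw [Finset.mem_union, not_or] at hv
            rw [not_not.1 fun hne => hv.1 (hαs v hne), not_not.1 fun hne => hv.2 (hβs v hne)]
        unfold latticePoint
        simp only [← hαβ]
        trans ∑ v ∈ s₀ ∪ s, ((α v : ℝ) / (p : ℝ)) • v
        · refine Finset.sum_subset Finset.subset_union_right fun v _ hv => ?_
          have : α v = 0 := not_not.1 fun hne => hv (hβs v (hαβ v ▸ hne))
          simp [this]
        · refine (Finset.sum_subset Finset.subset_union_left fun v _ hv => ?_).symm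
          have : α v = 0 := not_not.1 fun hne => hv (hαs v hne)
          simp [this]
      exact lagrange_eq_zero hv (hb v) hlt

open Classical in
theorem nodalBasis_spec (hp : 1 ≤ p) {z : E d} (hz : z ∈ nodes T p) (hzΩ : z ∈ T.domain) :
    nodalBasis T p z ∈ feSpace T p ∧
      ∀ y ∈ nodes T p, nodalBasis T p z y = if y = z then 1 else 0 :=
  Classical.epsilon_spec (p := fun v : E d → ℝ =>
    v ∈ feSpace T p ∧ ∀ y ∈ nodes T p, v y = if y = z then 1 else 0) (exists_nodal hp hz hzΩ)

/-- A finite element function which vanishes at the nodes of an element vanishes on it. -/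
theorem eq_zero_on_of_nodes (hp : 1 ≤ p) {v : E d → ℝ} (hv : v ∈ feSpace T p)
    {s : Finset (E d)} (hs : s ∈ T.elements)
    (h0 : ∀ y ∈ nodes T p, y ∈ convexHull ℝ (s : Set (E d)) → v y = 0) {x : E d}
    (hx : x ∈ convexHull ℝ (s : Set (E d))) : v x = 0 := by
  obtain ⟨q, hq, hqe⟩ := hv.2.2 s hs
  have : q = 0 := (T.isSimplex hs).eq_zero_of_eval_latticePoint hp hq fun α hα hαs => by
    have hm := latticePoint_mem_convexHull hp hα
    rw [← hqe _ hm]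
    exact h0 _ (mem_nodes.2 ⟨s, hs, α, hα, hαs, rfl⟩) hm
  rw [hqe x hx, this, map_zero]

theorem eq_zero_of_nodes (hp : 1 ≤ p) {v : E d → ℝ} (hv : v ∈ feSpace T p)
    (h0 : ∀ y ∈ nodes T p, v y = 0) : v = 0 := by
  funext x
  by_cases hx : x ∈ T.domain
  · obtain ⟨s, hs, hxs⟩ := mem_region.1 (T.domain_subset hx)
    exact eq_zero_on_of_nodes hp hv hs (fun y hy _ => h0 y hy) hxs
  · exact hv.2.1 x hx

theorem interp_mem (hp : 1 ≤ p) (w : E d → ℝ) : interp T p w ∈ feSpace T p := by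
  classical
  refine Submodule.sum_mem _ fun z hz => Submodule.smul_mem _ _ ?_
  rw [Finset.mem_filter] at hz
  exact (nodalBasis_spec hp hz.1 hz.2).1

theorem interp_apply (hp : 1 ≤ p) (w : E d → ℝ) {y : E d} (hy : y ∈ nodes T p)
    (hyΩ : y ∈ T.domain) : interp T p w y = w y := by
  classical
  change (∑ z ∈ (nodes T p).filter (fun z => z ∈ T.domain), w z • nodalBasis T p z) y = w y
  rw [Finset.sum_apply, Finset.sum_eq_single y]
  · rw [Pi.smul_apply, (nodalBasis_spec hp hy hyΩ).2 y hy, if_pos rfl, smul_eq_mul, mul_one]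
  · intro z hz hzy
    rw [Finset.mem_filter] at hz
    rw [Pi.smul_apply, (nodalBasis_spec hp hz.1 hz.2).2 y hy, if_neg hzy.symm, smul_zero]
  · intro h
    exact absurd (Finset.mem_filter.2 ⟨hy, hyΩ⟩) h

/-- Lagrange interpolation depends only on the values in the domain. -/
theorem interp_congr {w w' : E d → ℝ} (h : ∀ x ∈ T.domain, w x = w' x) :
    interp T p w = interp T p w' := by
  classical
  refine Finset.sum_congr rfl fun z hz => ?_
  rw [h z (Finset.mem_filter.1 hz).2]

theorem interp_eq_self (hp : 1 ≤ p) {v : E d → ℝ} (hv : v ∈ feSpace T p) : interp T p v = v := by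
  refine sub_eq_zero.1 (eq_zero_of_nodes hp (Submodule.sub_mem _ (interp_mem hp v) hv)
    fun y hy => ?_)
  rw [Pi.sub_apply, sub_eq_zero]
  by_cases hyΩ : y ∈ T.domain
  · exact interp_apply hp v hy hyΩ
  · rw [(interp_mem hp v).2.1 y hyΩ, hv.2.1 y hyΩ]

theorem finiteDimensional_feSpace (hp : 1 ≤ p) : FiniteDimensional ℝ (feSpace T p) := by
  classical
  have hle : feSpace T p ≤ Submodule.span ℝ
      (nodalBasis T p '' ((nodes T p).filter (fun z => z ∈ T.domain) : Finset (E d))) := by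
    intro v hv
    rw [← interp_eq_self hp hv]
    exact Submodule.sum_mem _ fun z hz => Submodule.smul_mem _ _
      (Submodule.subset_span ⟨z, hz, rfl⟩)
  have := FiniteDimensional.span_of_finite ℝ
    ((Finset.finite_toSet ((nodes T p).filter (fun z => z ∈ T.domain))).image (nodalBasis T p))
  exact Submodule.finiteDimensional_of_le hle

/-! ### Gradients of finite element functions and the energy form -/

theorem contDiff_eval (q : MvPolynomial (Fin d) ℝ) :
    ContDiff ℝ 1 fun x : E d => MvPolynomial.eval x.ofLp q := by
  induction q using MvPolynomial.induction_on with
  | C a => simpa using contDiff_const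
  | add q r hq hr => simpa using hq.add hr
  | mul_X q i hq =>
    simp only [map_mul, MvPolynomial.eval_X]
    exact hq.mul (by fun_prop)

theorem Triangulation.domain_isOpen (T : Triangulation d) : IsOpen T.domain := isOpen_interior

theorem Triangulation.isBounded_domain (T : Triangulation d) : Bornology.IsBounded T.domain := by
  refine Bornology.IsBounded.subset ?_ T.domain_subset
  exact (T.elements.finite_toSet.isCompact_biUnion fun s _ =>
    s.finite_toSet.isCompact_convexHull ℝ).isBounded

theorem interior_convexHull_subset_interior_region {S : Finset (Finset (E d))} {s : Finset (E d)}
    (hs : s ∈ S) : interior (convexHull ℝ (s : Set (E d))) ⊆ interior (region S) :=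
  interior_mono fun _ hx => mem_region.2 ⟨s, hs, hx⟩

/-- The boundary of a convex set is a null set. -/
theorem ae_mem_interior (S : Finset (Finset (E d))) :
    ∀ᵐ x : E d, ∀ s ∈ S, x ∈ convexHull ℝ (s : Set (E d)) →
      x ∈ interior (convexHull ℝ (s : Set (E d))) := by
  rw [Filter.eventually_all_finset]
  intro s _
  have h := (convex_convexHull ℝ (s : Set (E d))).addHaar_frontier volume
  filter_upwards [measure_eq_zero_iff_ae_notMem.1 h] with x hx hxs
  rw [(isClosed_convexHull s).frontier_eq] at hx
  by_contra hxi
  exact hx ⟨hxs, hxi⟩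

theorem ae_domain_mem_interior (T : Triangulation d) :
    ∀ᵐ x ∂(volume.restrict T.domain), ∃ s ∈ T.elements,
      x ∈ interior (convexHull ℝ (s : Set (E d))) := by
  filter_upwards [ae_restrict_of_ae (ae_mem_interior T.elements),
    ae_restrict_mem T.domain_isOpen.measurableSet] with x hx hxΩ
  obtain ⟨s, hs, hxs⟩ := mem_region.1 (T.domain_subset hxΩ)
  exact ⟨s, hs, hx s hs hxs⟩

/-- In the interior of an element a finite element function is a polynomial. -/
theorem eventuallyEq_eval {v : E d → ℝ} {s : Finset (E d)} {q : MvPolynomial (Fin d) ℝ}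
    (hq : ∀ x ∈ convexHull ℝ (s : Set (E d)), v x = MvPolynomial.eval x.ofLp q) {x : E d}
    (hx : x ∈ interior (convexHull ℝ (s : Set (E d)))) :
    v =ᶠ[nhds x] fun x => MvPolynomial.eval x.ofLp q :=
  (isOpen_interior.mem_nhds hx |> Filter.eventually_of_mem) fun y hy => hq y (interior_subset hy)

theorem differentiableAt_of_mem {v : E d → ℝ} (hv : v ∈ feSpace T p) {s : Finset (E d)}
    (hs : s ∈ T.elements) {x : E d} (hx : x ∈ interior (convexHull ℝ (s : Set (E d)))) :
    DifferentiableAt ℝ v x := by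
  obtain ⟨q, -, hq⟩ := hv.2.2 s hs
  exact ((contDiff_eval q).differentiable one_ne_zero x).congr_of_eventuallyEq
    (eventuallyEq_eval hq hx)

theorem ae_differentiableAt {v : E d → ℝ} (hv : v ∈ feSpace T p) :
    ∀ᵐ x ∂(volume.restrict T.domain), DifferentiableAt ℝ v x := by
  filter_upwards [ae_domain_mem_interior T] with x ⟨s, hs, hx⟩
  exact differentiableAt_of_mem hv hs hx

theorem norm_gradient (v : E d → ℝ) (x : E d) : ‖gradient v x‖ = ‖fderiv ℝ v x‖ := by
  rw [gradient, LinearIsometryEquiv.norm_map]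

theorem exists_gradient_bound {v : E d → ℝ} (hv : v ∈ feSpace T p) :
    ∃ C, ∀ᵐ x ∂(volume.restrict T.domain), ‖gradient v x‖ ≤ C := by
  have h : ∀ s : T.elements, ∃ C, ∀ x ∈ interior (convexHull ℝ (s.1 : Set (E d))),
      ‖gradient v x‖ ≤ C := by
    rintro ⟨s, hs⟩
    obtain ⟨q, -, hq⟩ := hv.2.2 s hs
    obtain ⟨C, hC⟩ := (s.finite_toSet.isCompact_convexHull ℝ).exists_bound_of_continuousOn
      ((contDiff_eval q).continuous_fderiv one_ne_zero).continuousOn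
    refine ⟨C, fun x hx => ?_⟩
    rw [norm_gradient, (eventuallyEq_eval hq hx).fderiv_eq]
    exact hC x (interior_subset hx)
  choose C hC using h
  refine ⟨∑ s, |C s|, ?_⟩
  filter_upwards [ae_domain_mem_interior T] with x ⟨s, hs, hx⟩
  refine (hC ⟨s, hs⟩ x hx).trans ((le_abs_self _).trans ?_)
  exact Finset.single_le_sum (f := fun s => |C s|) (fun s _ => abs_nonneg _) (Finset.mem_univ _)

theorem measurable_gradient (v : E d → ℝ) : Measurable (gradient v) :=
  ((InnerProductSpace.toDual ℝ (E d)).symm.continuous.measurable).comp (measurable_fderiv ℝ v)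

theorem gradient_add {u v : E d → ℝ} {x : E d} (hu : DifferentiableAt ℝ u x)
    (hv : DifferentiableAt ℝ v x) : gradient (u + v) x = gradient u x + gradient v x := by
  simp only [gradient, fderiv_add hu hv, map_add]

theorem gradient_smul {u : E d → ℝ} {x : E d} (c : ℝ) (hu : DifferentiableAt ℝ u x) :
    gradient (c • u) x = c • gradient u x := by
  simp [gradient, fderiv_const_smul hu]

theorem gradient_sum {ι : Type*} (s : Finset ι) {u : ι → E d → ℝ} {x : E d}
    (hu : ∀ i ∈ s, DifferentiableAt ℝ (u i) x) :
    gradient (∑ i ∈ s, u i) x = ∑ i ∈ s, gradient (u i) x := by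
  simp only [gradient, fderiv_sum hu, map_sum]

/-- The bilinear form `(ζ, η) ↦ A(x) ζ · η`. -/
def coeffForm (A : E d → Matrix (Fin d) (Fin d) ℝ) (x : E d) : E d →ₗ[ℝ] E d →ₗ[ℝ] ℝ :=
  LinearMap.mk₂ ℝ (fun ζ η => (A x *ᵥ ζ.ofLp) ⬝ᵥ η.ofLp)
    (fun _ _ _ => by simp [Matrix.mulVec_add]) (fun _ _ _ => by simp [Matrix.mulVec_smul])
    (fun _ _ _ => by simp) (fun _ _ _ => by simp)

variable {A : E d → Matrix (Fin d) (Fin d) ℝ}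

theorem energyForm_eq (ω : Set (E d)) (u v : E d → ℝ) :
    energyForm A ω u v = ∫ x in ω, coeffForm A x (gradient u x) (gradient v x) := rfl

theorem dotProduct_self_eq (ζ : E d) : ζ.ofLp ⬝ᵥ ζ.ofLp = ‖ζ‖ ^ 2 := by
  rw [EuclideanSpace.real_norm_sq_eq]
  simp [dotProduct, sq]

theorem IsCoefficient.ae_symm {Ω : Set (E d)} (hA : IsCoefficient Ω A) :
    ∀ᵐ x ∂(volume.restrict Ω), ∀ ζ η, coeffForm A x ζ η = coeffForm A x η ζ := by
  filter_upwards [hA.symm] with x hx ζ η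
  change (A x *ᵥ ζ.ofLp) ⬝ᵥ η.ofLp = (A x *ᵥ η.ofLp) ⬝ᵥ ζ.ofLp
  rw [dotProduct_comm, Matrix.dotProduct_mulVec, ← Matrix.mulVec_transpose, hx.eq]

theorem IsCoefficient.exists_bounds {Ω : Set (E d)} (hA : IsCoefficient Ω A) :
    ∃ α β : ℝ, 0 < α ∧ α < β ∧ ∀ᵐ x ∂(volume.restrict Ω), ∀ ζ : E d,
      α * ‖ζ‖ ^ 2 ≤ coeffForm A x ζ ζ ∧ coeffForm A x ζ ζ ≤ β * ‖ζ‖ ^ 2 := by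
  obtain ⟨α, β, hα, hαβ, h⟩ := hA.elliptic
  refine ⟨α, β, hα, hαβ, ?_⟩
  filter_upwards [h] with x hx ζ
  rw [← dotProduct_self_eq]
  exact hx ζ.ofLp

theorem IsCoefficient.ae_nonneg {Ω : Set (E d)} (hA : IsCoefficient Ω A) :
    ∀ᵐ x ∂(volume.restrict Ω), ∀ ζ, 0 ≤ coeffForm A x ζ ζ := by
  obtain ⟨α, β, hα, -, h⟩ := hA.exists_bounds
  filter_upwards [h] with x hx ζ
  exact le_trans (by positivity) (hx ζ).1

theorem integrableOn_domain (hA : IsCoefficient T.domain A) {u v : E d → ℝ}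
    (hu : u ∈ feSpace T p) (hv : v ∈ feSpace T p) :
    IntegrableOn (fun x => coeffForm A x (gradient u x) (gradient v x)) T.domain := by
  obtain ⟨α, β, hα, hαβ, hb⟩ := hA.exists_bounds
  obtain ⟨C, hC⟩ := exists_gradient_bound hu
  obtain ⟨C', hC'⟩ := exists_gradient_bound hv
  have : IsFiniteMeasure (volume.restrict T.domain) :=
    isFiniteMeasure_restrict.2 T.isBounded_domain.measure_lt_top.ne
  refine Integrable.of_bound ?_ (β * (C + C') ^ 2) ?_
  · have hcoord : ∀ (w : E d → ℝ) (i : Fin d), Measurable fun x => (gradient w x).ofLp i :=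
      fun w i => (EuclideanSpace.proj (𝕜 := ℝ) i).continuous.measurable.comp (measurable_gradient w)
    refine AEMeasurable.aestronglyMeasurable ?_
    change AEMeasurable (fun x => ∑ i, (∑ j, A x i j * (gradient u x).ofLp j) *
      (gradient v x).ofLp i) (volume.restrict T.domain)
    refine Finset.aemeasurable_fun_sum _ fun i _ => AEMeasurable.mul ?_ (hcoord v i).aemeasurable
    exact Finset.aemeasurable_fun_sum _ fun j _ => (hA.measurable i j).mul (hcoord u j).aemeasurable
  · filter_upwards [hb, hA.ae_symm, hC, hC'] with x hx hs hux hvx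
    set ζ := gradient u x
    set η := gradient v x
    -- Polarisation: four times the mixed value is the difference of the values at ζ + η and ζ - η,
    -- both between 0 and β (C + C')². No bound on the entries of A is needed.
    have h1 := hx (ζ + η)
    have h2 := hx (ζ - η)
    have hsymm := hs ζ η
    simp only [map_add, map_sub, LinearMap.add_apply, LinearMap.sub_apply] at h1 h2
    have n1 : ‖ζ + η‖ ^ 2 ≤ (C + C') ^ 2 := by
      have := norm_add_le ζ η
      gcongr
      linarith
    have n2 : ‖ζ - η‖ ^ 2 ≤ (C + C') ^ 2 := by
      have := norm_sub_le ζ η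
      gcongr
      linarith
    have m1 : β * ‖ζ + η‖ ^ 2 ≤ β * (C + C') ^ 2 := by gcongr; linarith
    have m2 : β * ‖ζ - η‖ ^ 2 ≤ β * (C + C') ^ 2 := by gcongr; linarith
    have p1 : 0 ≤ α * ‖ζ + η‖ ^ 2 := by positivity
    have p2 : 0 ≤ α * ‖ζ - η‖ ^ 2 := by positivity
    rw [Real.norm_eq_abs, abs_le]
    constructor <;> linarith

theorem integrableOn (hA : IsCoefficient T.domain A) {u v : E d → ℝ}
    (hu : u ∈ feSpace T p) (hv : v ∈ feSpace T p) {ω : Set (E d)} (hω : ω ⊆ T.domain) :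
    IntegrableOn (fun x => coeffForm A x (gradient u x) (gradient v x)) ω :=
  (integrableOn_domain hA hu hv).mono_set hω

theorem ae_of_subset {Ω ω : Set (E d)} (hω : ω ⊆ Ω) {P : E d → Prop}
    (h : ∀ᵐ x ∂(volume.restrict Ω), P x) : ∀ᵐ x ∂(volume.restrict ω), P x :=
  ae_mono (Measure.restrict_mono hω le_rfl) h

theorem energyForm_symm (hA : IsCoefficient T.domain A) {ω : Set (E d)} (hω : ω ⊆ T.domain)
    (u v : E d → ℝ) : energyForm A ω u v = energyForm A ω v u := by
  refine integral_congr_ae ?_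
  filter_upwards [ae_of_subset hω hA.ae_symm] with x hx
  exact hx _ _

theorem energyForm_nonneg (hA : IsCoefficient T.domain A) {ω : Set (E d)} (hω : ω ⊆ T.domain)
    (u : E d → ℝ) : 0 ≤ energyForm A ω u u := by
  refine integral_nonneg_of_ae ?_
  filter_upwards [ae_of_subset hω hA.ae_nonneg] with x hx
  exact hx _

theorem energyForm_add_left (hA : IsCoefficient T.domain A) {ω : Set (E d)} (hω : ω ⊆ T.domain)
    {u u' v : E d → ℝ} (hu : u ∈ feSpace T p) (hu' : u' ∈ feSpace T p) (hv : v ∈ feSpace T p) :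
    energyForm A ω (u + u') v = energyForm A ω u v + energyForm A ω u' v := by
  simp only [energyForm_eq]
  rw [← integral_add (integrableOn hA hu hv hω) (integrableOn hA hu' hv hω)]
  refine integral_congr_ae ?_
  filter_upwards [ae_of_subset hω (ae_differentiableAt hu),
    ae_of_subset hω (ae_differentiableAt hu')] with x hx hx'
  rw [gradient_add hx hx', map_add, LinearMap.add_apply]

theorem energyForm_smul_left {ω : Set (E d)} (hω : ω ⊆ T.domain)
    {u v : E d → ℝ} (c : ℝ) (hu : u ∈ feSpace T p) :
    energyForm A ω (c • u) v = c * energyForm A ω u v := by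
  simp only [energyForm_eq]
  rw [← integral_const_mul]
  refine integral_congr_ae ?_
  filter_upwards [ae_of_subset hω (ae_differentiableAt hu)] with x hx
  rw [gradient_smul c hx, map_smul, LinearMap.smul_apply, smul_eq_mul]

/-- The energy form on a subdomain as a bilinear form on the finite element space. -/
def energyBilin (p : ℕ) (hA : IsCoefficient T.domain A) {ω : Set (E d)} (hω : ω ⊆ T.domain) :
    feSpace T p →ₗ[ℝ] feSpace T p →ₗ[ℝ] ℝ :=
  LinearMap.mk₂ ℝ (fun u v => energyForm A ω u v)
    (fun u u' v => energyForm_add_left hA hω u.2 u'.2 v.2)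
    (fun c u _ => energyForm_smul_left hω c u.2)
    (fun u v v' => by
      rw [energyForm_symm hA hω, energyForm_symm hA hω (u : E d → ℝ) v,
        energyForm_symm hA hω (u : E d → ℝ) v']
      exact energyForm_add_left hA hω v.2 v'.2 u.2)
    (fun c u v => by
      rw [energyForm_symm hA hω, energyForm_symm hA hω (u : E d → ℝ) v]
      exact energyForm_smul_left hω c v.2)

theorem energyBilin_apply (hA : IsCoefficient T.domain A) {ω : Set (E d)} (hω : ω ⊆ T.domain)
    (u v : feSpace T p) : energyBilin p hA hω u v = energyForm A ω u v := rfl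

/-- A finite element function without energy vanishes. -/
theorem eq_zero_of_energyForm (hd : 0 < d) (hA : IsCoefficient T.domain A) {v : E d → ℝ}
    (hv : v ∈ feSpace T p) (h0 : energyForm A T.domain v v = 0) : v = 0 := by
  obtain ⟨α, β, hα, -, hb⟩ := hA.exists_bounds
  have hgrad : ∀ᵐ x ∂(volume.restrict T.domain), fderiv ℝ v x = 0 := by
    have hnn : 0 ≤ᵐ[volume.restrict T.domain]
        fun x => coeffForm A x (gradient v x) (gradient v x) := by
      filter_upwards [hA.ae_nonneg] with x hx
      exact hx _
    have := (setIntegral_eq_zero_iff_of_nonneg_ae hnn (integrableOn_domain hA hv hv)).1 h0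
    filter_upwards [this, hb] with x hx hbx
    have h1 := (hbx (gradient v x)).1
    rw [hx, Pi.zero_apply, norm_gradient] at h1
    have h2 : ‖fderiv ℝ v x‖ ^ 2 ≤ 0 := nonpos_of_mul_nonpos_right h1 hα
    exact norm_eq_zero.1 (pow_eq_zero_iff two_ne_zero |>.1 (le_antisymm h2 (sq_nonneg _)))
  have hconst : ∀ s ∈ T.elements, (v '' convexHull ℝ (s : Set (E d))).Subsingleton := by
    intro s hs
    obtain ⟨q, -, hq⟩ := hv.2.2 s hs
    set U := interior (convexHull ℝ (s : Set (E d))) with hU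
    have hdU : U ⊆ T.domain := interior_convexHull_subset_interior_region hs
    have heq : Set.EqOn (fderiv ℝ fun x : E d => MvPolynomial.eval x.ofLp q) 0 U := by
      -- The derivative of a polynomial is continuous, so vanishing almost everywhere on an open set
      -- means vanishing there.
      refine Measure.eqOn_open_of_ae_eq (μ := volume) ?_ isOpen_interior
        ((contDiff_eval q).continuous_fderiv one_ne_zero).continuousOn continuousOn_const
      filter_upwards [ae_of_subset hdU hgrad, ae_restrict_mem isOpen_interior.measurableSet]
        with x hx hxU
      rw [← (eventuallyEq_eval hq hxU).fderiv_eq, hx]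
      rfl
    have hne : U.Nonempty := by
      have := (T.isSimplex hs).basis.centroid_mem_interior_convexHull
      rw [(T.isSimplex hs).range_basis] at this
      exact ⟨_, this⟩
    obtain ⟨x₀, hx₀⟩ := hne
    have hU0 : ∀ x ∈ U, v x = v x₀ := fun x hx => by
      rw [hq x (interior_subset hx), hq x₀ (interior_subset hx₀)]
      exact isOpen_interior.is_const_of_fderiv_eq_zero (𝕜 := ℝ)
        (convex_convexHull ℝ _).interior.isPreconnected
        ((contDiff_eval q).differentiable one_ne_zero).differentiableOn heq hx hx₀
    have hall : ∀ x ∈ convexHull ℝ (s : Set (E d)), v x = v x₀ := by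
      intro x hx
      have hx' : x ∈ closure U := by
        rw [hU, (convex_convexHull ℝ _).closure_interior_eq_closure_of_nonempty_interior
          ⟨x₀, hx₀⟩]
        exact subset_closure hx
      exact (closure_minimal (fun y hy => hU0 y hy)
        (isClosed_eq hv.1 continuous_const)) hx'
    rintro _ ⟨x, hx, rfl⟩ _ ⟨y, hy, rfl⟩
    rw [hall x hx, hall y hy]
  -- At most one value on each element and the value 0 outside: a continuous function on a connected
  -- space with finitely many values is constant. Connectedness of the domain plays no role.
  have hfin : (Set.range v).Finite := by
    have : Set.range v ⊆ {0} ∪ ⋃ s ∈ T.elements, v '' convexHull ℝ (s : Set (E d)) := by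
      rintro _ ⟨x, rfl⟩
      by_cases hx : x ∈ T.domain
      · obtain ⟨s, hs, hxs⟩ := mem_region.1 (T.domain_subset hx)
        exact Or.inr (Set.mem_biUnion hs ⟨x, hxs, rfl⟩)
      · exact Or.inl (hv.2.1 x hx)
    exact ((Set.finite_singleton 0).union (T.elements.finite_toSet.biUnion fun s hs =>
      (hconst s hs).finite)).subset this
  have hsub : (Set.range v).Subsingleton := by
    rw [← Set.not_nontrivial_iff]
    exact fun hnt => (isPreconnected_range hv.1).infinite_of_nontrivial hnt hfin
  -- For d > 0 the space is unbounded, so there is a point outside the bounded domain, where v = 0.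
  have : Nonempty (Fin d) := ⟨⟨0, hd⟩⟩
  obtain ⟨y, hy⟩ : ∃ y, y ∉ T.domain := by
    by_contra! h
    exact NormedSpace.unbounded_univ ℝ (E d)
      (T.isBounded_domain.subset fun x _ => h x)
  funext x
  rw [hsub ⟨x, rfl⟩ ⟨y, rfl⟩, hv.2.1 y hy]
  rfl

/-! ### Subdomains resolved by the mesh -/

theorem Triangulation.Resolves.subset_domain {ω : Set (E d)} (h : T.Resolves ω) :
    ω ⊆ T.domain := by
  obtain ⟨S, hS, rfl⟩ := h
  refine interior_mono fun x hx => ?_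
  obtain ⟨s, hs, hxs⟩ := mem_region.1 hx
  exact mem_region.2 ⟨s, hS hs, hxs⟩

theorem Triangulation.Resolves.isOpen {ω : Set (E d)} (h : T.Resolves ω) : IsOpen ω := by
  obtain ⟨S, -, rfl⟩ := h
  exact isOpen_interior

theorem closure_interior_region_subset (S : Finset (Finset (E d))) :
    closure (interior (region S)) ⊆ region S :=
  closure_minimal interior_subset (isClosed_region S)

/-- The closure of ω stays inside its union of elements, and almost every point of an element is
interior to it, hence in ω. -/
theorem Triangulation.Resolves.ae_notMem_closure {ω : Set (E d)} (h : T.Resolves ω) :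
    ∀ᵐ x : E d, x ∉ ω → x ∉ closure ω := by
  obtain ⟨S, -, rfl⟩ := h
  filter_upwards [ae_mem_interior S] with x hx hxω hxc
  obtain ⟨s, hs, hxs⟩ := mem_region.1 (closure_interior_region_subset S hxc)
  exact hxω (interior_convexHull_subset_interior_region hs (hx s hs hxs))

theorem gradient_eq_zero_of_notMem_tsupport {w : E d → ℝ} {x : E d} (hx : x ∉ tsupport w) :
    gradient w x = 0 := by
  have h : w =ᶠ[nhds x] fun _ => 0 := notMem_tsupport_iff_eventuallyEq.1 hx
  rw [h.gradient_eq, gradient_fun_const]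

theorem ae_gradient_eq_zero_of_localSpaceZero {ω : Set (E d)} (h : T.Resolves ω) {w : E d → ℝ}
    (hw : w ∈ localSpaceZero T p ω) :
    ∀ᵐ x ∂(volume.restrict T.domain), x ∉ ω → gradient w x = 0 := by
  filter_upwards [ae_restrict_of_ae h.ae_notMem_closure] with x hx hxω
  exact gradient_eq_zero_of_notMem_tsupport fun hxs => hx hxω (hw.2 hxs)

/-- A function without gradient off `ω` sees only the energy on `ω`. -/
theorem energyForm_domain_eq {ω : Set (E d)} (hω : ω ⊆ T.domain) {w : E d → ℝ}
    (hw : ∀ᵐ x ∂(volume.restrict T.domain), x ∉ ω → gradient w x = 0) (v : E d → ℝ) :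
    energyForm A T.domain v w = energyForm A ω v w := by
  simp only [energyForm_eq]
  refine setIntegral_eq_of_subset_of_ae_sdiff_eq_zero
    T.domain_isOpen.measurableSet.nullMeasurableSet hω ?_
  filter_upwards [(ae_restrict_iff' T.domain_isOpen.measurableSet).1 hw] with x hx hxd
  rw [hx hxd.1 hxd.2, map_zero]

theorem gradient_restr {ω : Set (E d)} (hω : IsOpen ω) (v : E d → ℝ) {x : E d} (hx : x ∈ ω) :
    gradient (restr ω v) x = gradient v x := by
  refine Filter.EventuallyEq.gradient_eq ?_
  exact Filter.eventually_of_mem (hω.mem_nhds hx) fun y hy => Set.indicator_of_mem hy v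

theorem energyForm_restr_left {ω : Set (E d)} (hω : IsOpen ω) (u v : E d → ℝ) :
    energyForm A ω (restr ω u) v = energyForm A ω u v := by
  refine setIntegral_congr_fun hω.measurableSet fun x hx => ?_
  simp only [gradient_restr hω u hx]

theorem energyForm_restr_right {ω : Set (E d)} (hω : IsOpen ω) (u v : E d → ℝ) :
    energyForm A ω u (restr ω v) = energyForm A ω u v := by
  refine setIntegral_congr_fun hω.measurableSet fun x hx => ?_
  simp only [gradient_restr hω v hx]

/-! ### The discrete partition of unity -/

section Decomposition

variable {M : ℕ} (D : Decomposition T M)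

/-- The support condition only gives zero off the closure of ω_i. A nonzero value persists in a
neighbourhood, which then lies in the closed union of elements; as ω_i is the interior of that
union, the point belongs to ω_i. -/
theorem Decomposition.χ_eq_zero (i : Fin M) {x : E d} (hx : x ∈ T.domain) (hxi : x ∉ D.ω i) :
    D.χ i x = 0 := by
  by_contra hne
  have hev : ∀ᶠ y in nhds x, D.χ i y ≠ 0 :=
    ((D.χ_cont i).continuousAt (T.domain_isOpen.mem_nhds hx)).eventually_ne hne
  have hsupp := D.χ_supp i
  obtain ⟨S, -, hS⟩ := D.resolves_ω i
  rw [hS] at hxi hsupp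
  refine hxi (mem_interior_iff_mem_nhds.2 ?_)
  filter_upwards [hev, T.domain_isOpen.mem_nhds hx] with y hy hyΩ
  by_contra hyS
  exact hy (hsupp y hyΩ fun hyc => hyS (closure_interior_region_subset S hyc))

/-- The partition of unity operator uses only the values on the subdomain. -/
theorem pou_restr (i : Fin M) {ω : Set (E d)} (hω : D.ω i ⊆ ω) (v : E d → ℝ) :
    pou T p D i (restr ω v) = pou T p D i v := by
  refine interp_congr fun x hx => ?_
  rw [Pi.mul_apply, Pi.mul_apply]
  by_cases hxi : x ∈ D.ω i
  · rw [show restr ω v x = v x from Set.indicator_of_mem (hω hxi) v]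
  · rw [D.χ_eq_zero i hx hxi, zero_mul, zero_mul]

theorem pou_mem (hp : 1 ≤ p) (i : Fin M) (v : E d → ℝ) : pou T p D i v ∈ feSpace T p :=
  interp_mem hp _

theorem sum_pou (hp : 1 ≤ p) {v : E d → ℝ} (hv : v ∈ feSpace T p) :
    ∑ i, pou T p D i v = v := by
  conv_rhs => rw [← interp_eq_self hp hv]
  change ∑ i, interp T p (D.χ i * v) = _
  rw [← map_sum]
  refine interp_congr fun x hx => ?_
  simp only [Finset.sum_apply, Pi.mul_apply]
  rw [← Finset.sum_mul, D.χ_sum x hx, one_mul]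

/-- A node of t in the open set ω_i would be a limit of interior points of t and force an
intersection. So χ_i, or membership in V_h, gives zero at every node of t, and unisolvence does the
rest. Interpolation thus does not enlarge the support beyond the resolved subdomain. -/
theorem pou_eq_zero (hp : 1 ≤ p) (i : Fin M) (v : E d → ℝ) {t : Finset (E d)}
    (ht : t ∈ T.elements) (hti : Disjoint (interior (convexHull ℝ (t : Set (E d)))) (D.ω i))
    {x : E d} (hx : x ∈ convexHull ℝ (t : Set (E d))) : pou T p D i v x = 0 := by
  refine eq_zero_on_of_nodes hp (pou_mem D hp i v) ht (fun y hy hyt => ?_) hx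
  by_cases hyΩ : y ∈ T.domain
  · have hyi : y ∉ D.ω i := by
      intro hyi
      have hne : (interior (convexHull ℝ (t : Set (E d)))).Nonempty := by
        have := (T.isSimplex ht).basis.centroid_mem_interior_convexHull
        rw [(T.isSimplex ht).range_basis] at this
        exact ⟨_, this⟩
      have hyc : y ∈ closure (interior (convexHull ℝ (t : Set (E d)))) := by
        rw [(convex_convexHull ℝ _).closure_interior_eq_closure_of_nonempty_interior hne]
        exact subset_closure hyt
      obtain ⟨z, hz, hz'⟩ := mem_closure_iff.1 hyc _ (D.resolves_ω i).isOpen hyi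
      exact Set.disjoint_left.1 hti hz' hz
    refine (interp_apply hp _ hy hyΩ).trans ?_
    rw [Pi.mul_apply, D.χ_eq_zero i hyΩ hyi, zero_mul]
  · exact (pou_mem D hp i v).2.1 y hyΩ

/-- The interior of an element lies in a resolved set or does not meet it. -/
theorem Triangulation.Resolves.interior_subset_or_disjoint {ω : Set (E d)} (h : T.Resolves ω)
    {t : Finset (E d)} (ht : t ∈ T.elements) :
    interior (convexHull ℝ (t : Set (E d))) ⊆ ω ∨
      Disjoint (interior (convexHull ℝ (t : Set (E d)))) ω := by
  obtain ⟨S, hS, rfl⟩ := h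
  rw [or_iff_not_imp_right, Set.not_disjoint_iff]
  rintro ⟨y, hyt, hyS⟩
  obtain ⟨s, hs, hys⟩ := mem_region.1 (interior_subset hyS)
  -- All coordinates with respect to t are positive at y and agree with those of s, so each vertex
  -- of t is a vertex of s.
  have hts : t ⊆ s := fun v hv => by
    refine mem_of_bary_ne_zero (x := y) ?_
    rw [T.bary_eq_bary (hS hs) ht hys (interior_subset hyt)]
    exact ((T.isSimplex ht).mem_interior_iff.1 hyt v hv).ne'
  have : t = s := Finset.eq_of_subset_of_card_le hts
    (by rw [T.card_eq t ht, T.card_eq s (hS hs)])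
  rw [this]
  exact interior_convexHull_subset_interior_region hs

theorem ae_gradient_pou (hp : 1 ≤ p) (i : Fin M) (v : E d → ℝ) :
    ∀ᵐ x ∂(volume.restrict T.domain), x ∉ D.ω i → gradient (pou T p D i v) x = 0 := by
  filter_upwards [ae_domain_mem_interior T] with x ⟨t, ht, hx⟩ hxi
  have hdisj := ((D.resolves_ω i).interior_subset_or_disjoint ht).resolve_left
    fun h => hxi (h hx)
  have h : pou T p D i v =ᶠ[nhds x] fun _ => 0 :=
    Filter.eventually_of_mem (isOpen_interior.mem_nhds hx) fun y hy =>
      pou_eq_zero D hp i v ht hdisj (interior_subset hy)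
  rw [h.gradient_eq, gradient_fun_const]

end Decomposition

/-! ### Overlap counts and sums of local energies -/

theorem ncard_le_overlap {M : ℕ} {Ω : Set (E d)} (U : Fin M → Set (E d)) {x : E d} (hx : x ∈ Ω) :
    {i | x ∈ U i}.ncard ≤ overlap Ω U := by
  -- A supremum in ℕ is an upper bound only for a bounded set; here M bounds every count.
  refine le_csSup ⟨M, ?_⟩ ⟨x, hx, rfl⟩
  rintro _ ⟨y, -, rfl⟩
  exact (Set.ncard_le_ncard (Set.subset_univ _)).trans (by simp [Set.ncard_univ])

/-- The Cauchy-Schwarz inequality for a sum of vectors. -/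
theorem apply_sum_le_card_mul {V ι : Type*} [AddCommGroup V] [Module ℝ V]
    {B : V →ₗ[ℝ] V →ₗ[ℝ] ℝ} (hs : ∀ x y, B x y = B y x) (hB : ∀ x, 0 ≤ B x x)
    (I : Finset ι) (x : ι → V) :
    B (∑ i ∈ I, x i) (∑ i ∈ I, x i) ≤ I.card * ∑ i ∈ I, B (x i) (x i) := by
  have h : ∀ i j, B (x i) (x j) ≤ (B (x i) (x i) + B (x j) (x j)) / 2 := fun i j => by
    have := hB (x i - x j)
    simp only [map_sub, LinearMap.sub_apply] at this
    rw [hs (x j) (x i)] at this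
    linarith
  calc B (∑ i ∈ I, x i) (∑ i ∈ I, x i) = ∑ i ∈ I, ∑ j ∈ I, B (x i) (x j) := by
        simp only [map_sum, LinearMap.sum_apply]
        exact Finset.sum_comm
    _ ≤ ∑ i ∈ I, ∑ j ∈ I, (B (x i) (x i) + B (x j) (x j)) / 2 :=
        Finset.sum_le_sum fun i _ => Finset.sum_le_sum fun j _ => h i j
    _ = I.card * ∑ i ∈ I, B (x i) (x i) := by
        simp only [← Finset.sum_div, Finset.sum_add_distrib, Finset.sum_const, nsmul_eq_mul,
          ← Finset.mul_sum]
        ring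

/-- Cauchy-Schwarz is applied pointwise: at x only the indices with x in `U i` contribute a
gradient, so the factor is the overlap and not M. -/
theorem energyForm_sum_le {M : ℕ} (hA : IsCoefficient T.domain A) {U : Fin M → Set (E d)}
    (hU : ∀ i, U i ⊆ T.domain) {w : Fin M → E d → ℝ} (hw : ∀ i, w i ∈ feSpace T p)
    (hwU : ∀ i, ∀ᵐ x ∂(volume.restrict T.domain), x ∉ U i → gradient (w i) x = 0) :
    energyForm A T.domain (∑ i, w i) (∑ i, w i) ≤
      overlap T.domain U * ∑ i, energyForm A (U i) (w i) (w i) := by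
  classical
  have hsum : ∑ i, energyForm A (U i) (w i) (w i) =
      ∫ x in T.domain, ∑ i, coeffForm A x (gradient (w i) x) (gradient (w i) x) := by
    rw [integral_finsetSum _ fun i _ => integrableOn_domain hA (hw i) (hw i)]
    exact Finset.sum_congr rfl fun i _ => (energyForm_domain_eq (hU i) (hwU i) (w i)).symm
  rw [hsum, energyForm_eq, ← integral_const_mul]
  have hs : ∑ i, w i ∈ feSpace T p := Submodule.sum_mem _ fun i _ => hw i
  refine integral_mono_ae (integrableOn_domain hA hs hs) ((integrable_finsetSum _ fun i _ =>
    integrableOn_domain hA (hw i) (hw i)).const_mul _) ?_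
  filter_upwards [hA.ae_symm, hA.ae_nonneg, ae_all_iff.2 hwU,
    ae_all_iff.2 fun i => ae_differentiableAt (hw i), ae_restrict_mem T.domain_isOpen.measurableSet]
    with x hxs hxn hxU hxd hxΩ
  rw [gradient_sum _ fun i _ => hxd i]
  set I : Finset (Fin M) := Finset.univ.filter fun i => x ∈ U i with hI
  have hcard : I.card ≤ overlap T.domain U := by
    refine le_trans (le_of_eq ?_) (ncard_le_overlap U hxΩ)
    rw [← Set.ncard_coe_finset]
    simp [hI]
  have h1 : ∑ i, gradient (w i) x = ∑ i ∈ I, gradient (w i) x := by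
    refine (Finset.sum_subset (Finset.subset_univ _) fun i _ hi => hxU i fun hxi => hi ?_).symm
    simp [hI, hxi]
  rw [h1]
  refine (apply_sum_le_card_mul hxs hxn I _).trans ?_
  refine mul_le_mul (by exact_mod_cast hcard) ?_ (Finset.sum_nonneg fun i _ => hxn _)
    (Nat.cast_nonneg _)
  exact Finset.sum_le_sum_of_subset_of_nonneg (Finset.subset_univ _) fun i _ _ => hxn _

theorem sum_energyForm_le {M : ℕ} (hA : IsCoefficient T.domain A) {U : Fin M → Set (E d)}
    (hU : ∀ i, U i ⊆ T.domain) (hUo : ∀ i, IsOpen (U i)) {v : E d → ℝ} (hv : v ∈ feSpace T p) :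
    ∑ i, energyForm A (U i) v v ≤ overlap T.domain U * energyForm A T.domain v v := by
  classical
  have hint := integrableOn_domain hA hv hv
  have hind : ∀ i, energyForm A (U i) v v = ∫ x in T.domain,
      (U i).indicator (fun x => coeffForm A x (gradient v x) (gradient v x)) x := fun i => by
    rw [setIntegral_indicator (hUo i).measurableSet, Set.inter_eq_right.2 (hU i)]
    rfl
  have hinti : ∀ i, Integrable ((U i).indicator
      (fun x => coeffForm A x (gradient v x) (gradient v x))) (volume.restrict T.domain) :=
    fun i => hint.indicator (hUo i).measurableSet
  simp only [hind]
  rw [← integral_finsetSum _ fun i _ => hinti i, energyForm_eq, ← integral_const_mul]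
  refine integral_mono_ae (integrable_finsetSum _ fun i _ => hinti i) (hint.const_mul _) ?_
  filter_upwards [hA.ae_nonneg, ae_restrict_mem T.domain_isOpen.measurableSet] with x hxn hxΩ
  simp only [Set.indicator_apply]
  rw [← Finset.sum_filter, Finset.sum_const, nsmul_eq_mul]
  refine mul_le_mul_of_nonneg_right ?_ (hxn _)
  refine Nat.cast_le.2 (le_trans (le_of_eq ?_) (ncard_le_overlap U hxΩ))
  rw [← Set.ncard_coe_finset]
  simp

/-! ### Energy projections and the map G -/

/-- The `a`-orthogonal projection exists and has its defining property. -/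
theorem aProj_spec (hd : 0 < d) (hp : 1 ≤ p) (hA : IsCoefficient T.domain A) {ω : Set (E d)}
    (hω : ω ⊆ T.domain) {W : Submodule ℝ (E d → ℝ)} (hW : W ≤ feSpace T p)
    (hWω : ∀ z ∈ W, ∀ᵐ x ∂(volume.restrict T.domain), x ∉ ω → gradient z x = 0)
    {v : E d → ℝ} (hv : v ∈ feSpace T p) :
    aProj T A ω W v ∈ W ∧
      ∀ z ∈ W, energyForm A ω (aProj T A ω W v) z = energyForm A T.domain v z := by
  refine Classical.epsilon_spec (p := fun w : E d → ℝ =>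
    w ∈ (W : Set (E d → ℝ)) ∧
      ∀ z ∈ (W : Set (E d → ℝ)), energyForm A ω w z = energyForm A T.domain v z) ?_
  have := finiteDimensional_feSpace (T := T) hp
  have : FiniteDimensional ℝ W := Submodule.finiteDimensional_of_le hW
  let ι : W →ₗ[ℝ] feSpace T p := Submodule.inclusion hW
  let B := energyBilin p hA (subset_refl T.domain)
  -- The Gram map of a on W: definiteness makes it injective, so in finite dimension it is onto the
  -- dual.
  let L : W →ₗ[ℝ] (W →ₗ[ℝ] ℝ) := B.compl₁₂ ι ι
  have hinj : Function.Injective L := by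
    rw [injective_iff_map_eq_zero]
    intro w hw
    have h0 : energyForm A T.domain (w : E d → ℝ) w = 0 := LinearMap.congr_fun hw w
    exact Subtype.ext (eq_zero_of_energyForm hd hA (hW w.2) h0)
  have hsurj := (LinearMap.injective_iff_surjective_of_finrank_eq_finrank
    (Subspace.dual_finrank_eq (K := ℝ) (V := W)).symm).1 hinj
  obtain ⟨w, hw⟩ := hsurj ((B ⟨v, hv⟩).comp ι)
  refine ⟨w, w.2, fun z hz => ?_⟩
  rw [← energyForm_domain_eq hω (hWω z hz)]
  exact LinearMap.congr_fun hw ⟨z, hz⟩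

theorem aProj_zero (hd : 0 < d) (hp : 1 ≤ p) (hA : IsCoefficient T.domain A) {ω : Set (E d)}
    (hω : ω ⊆ T.domain) {W : Submodule ℝ (E d → ℝ)} (hW : W ≤ feSpace T p)
    (hWω : ∀ z ∈ W, ∀ᵐ x ∂(volume.restrict T.domain), x ∉ ω → gradient z x = 0) :
    aProj T A ω W 0 = 0 := by
  obtain ⟨h1, h2⟩ := aProj_spec hd hp hA hω hW hWω (Submodule.zero_mem _)
  refine eq_zero_of_energyForm hd hA (hW h1) ?_
  rw [energyForm_domain_eq hω (hWω _ h1), h2 _ h1]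
  exact LinearMap.congr_fun (map_zero (energyBilin p hA (subset_refl T.domain))) ⟨_, hW h1⟩

theorem mem_localSpaceZero {ω : Set (E d)} {v : E d → ℝ} :
    v ∈ localSpaceZero T p ω ↔ v ∈ feSpace T p ∧ ∀ x, x ∉ closure ω → v x = 0 := by
  refine and_congr_right fun _ => ⟨fun h x hx => ?_, fun h => ?_⟩
  · exact image_eq_zero_of_notMem_tsupport fun hxs => hx (h hxs)
  · refine closure_minimal (fun x hx => ?_) isClosed_closure
    by_contra hxω
    exact hx (h x hxω)

/-- `V_{h,0}(ω)` as a subspace. -/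
def localSubmoduleZero (T : Triangulation d) (p : ℕ) (ω : Set (E d)) :
    Submodule ℝ (E d → ℝ) where
  carrier := localSpaceZero T p ω
  zero_mem' := mem_localSpaceZero.2 ⟨Submodule.zero_mem _, fun _ _ => rfl⟩
  add_mem' := by
    intro u v hu hv
    rw [mem_localSpaceZero] at *
    exact ⟨Submodule.add_mem _ hu.1 hv.1, fun x hx => by simp [hu.2 x hx, hv.2 x hx]⟩
  smul_mem' := by
    intro c u hu
    rw [mem_localSpaceZero] at *
    exact ⟨Submodule.smul_mem _ c hu.1, fun x hx => by simp [hu.2 x hx]⟩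

section Decomposition

variable {M : ℕ} (D : Decomposition T M)

/-- `S_m(Ω)` as a subspace. -/
def globalSubmodule (p : ℕ) {N : Fin M → ℕ} (φ : (i : Fin M) → Fin (N i) → E d → ℝ)
    (m : Fin M → ℕ) : Submodule ℝ (E d → ℝ) where
  carrier := globalApprox T p D φ m
  zero_mem' := ⟨0, fun _ => Submodule.zero_mem _, by simp⟩
  add_mem' := by
    rintro _ _ ⟨f, hf, rfl⟩ ⟨g, hg, rfl⟩
    exact ⟨f + g, fun i => Submodule.add_mem _ (hf i) (hg i), by
      simp [Finset.sum_add_distrib]⟩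
  smul_mem' := by
    rintro c _ ⟨f, hf, rfl⟩
    exact ⟨c • f, fun i => Submodule.smul_mem _ c (hf i), by simp [Finset.smul_sum]⟩

theorem globalSubmodule_le (hp : 1 ≤ p) {N : Fin M → ℕ}
    (φ : (i : Fin M) → Fin (N i) → E d → ℝ) (m : Fin M → ℕ) :
    globalSubmodule D p φ m ≤ feSpace T p := by
  rintro _ ⟨f, -, rfl⟩
  exact Submodule.sum_mem _ fun i _ => pou_mem D hp i _

theorem aProj_local_spec (hd : 0 < d) (hp : 1 ≤ p) (hA : IsCoefficient T.domain A)
    (i : Fin M) {v : E d → ℝ} (hv : v ∈ feSpace T p) :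
    aProj T A (D.ωs i) (localSpaceZero T p (D.ωs i)) v ∈ localSpaceZero T p (D.ωs i) ∧
      ∀ z ∈ localSpaceZero T p (D.ωs i),
        energyForm A (D.ωs i) (aProj T A (D.ωs i) (localSpaceZero T p (D.ωs i)) v) z =
          energyForm A T.domain v z :=
  aProj_spec (W := localSubmoduleZero T p (D.ωs i)) hd hp hA (D.resolves_ωs i).subset_domain
    (fun _ hz => hz.1)
    (fun _ hz => ae_gradient_eq_zero_of_localSpaceZero (D.resolves_ωs i) hz) hv

theorem aProj_global_spec (hd : 0 < d) (hp : 1 ≤ p) (hA : IsCoefficient T.domain A)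
    {N : Fin M → ℕ} (φ : (i : Fin M) → Fin (N i) → E d → ℝ)
    (m : Fin M → ℕ) {v : E d → ℝ} (hv : v ∈ feSpace T p) :
    aProj T A T.domain (globalApprox T p D φ m) v ∈ globalSubmodule D p φ m ∧
      ∀ z ∈ globalSubmodule D p φ m,
        energyForm A T.domain (aProj T A T.domain (globalApprox T p D φ m) v) z =
          energyForm A T.domain v z :=
  aProj_spec (W := globalSubmodule D p φ m) hd hp hA subset_rfl (globalSubmodule_le D hp φ m)
    (fun _ _ => (ae_restrict_mem T.domain_isOpen.measurableSet).mono fun _ hx h => absurd hx h) hv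

theorem msgfemMap_zero (hd : 0 < d) (hp : 1 ≤ p) (hA : IsCoefficient T.domain A)
    {N : Fin M → ℕ} (φ : (i : Fin M) → Fin (N i) → E d → ℝ)
    (m : Fin M → ℕ) : msgfemMap T p A D φ m 0 = 0 := by
  have h1 : ∀ i, aProj T A (D.ωs i) (localSpaceZero T p (D.ωs i)) 0 = 0 := fun i =>
    aProj_zero (W := localSubmoduleZero T p (D.ωs i)) hd hp hA (D.resolves_ωs i).subset_domain
      (fun _ hz => hz.1)
      (fun _ hz => ae_gradient_eq_zero_of_localSpaceZero (D.resolves_ωs i) hz)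
  have h2 : aProj T A T.domain (globalApprox T p D φ m) 0 = 0 :=
    aProj_zero (W := globalSubmodule D p φ m) hd hp hA subset_rfl (globalSubmodule_le D hp φ m)
      (fun _ _ => (ae_restrict_mem T.domain_isOpen.measurableSet).mono fun _ hx h => absurd hx h)
  have h3 : localSolves T p A D 0 = 0 := by
    unfold localSolves
    simp [h1]
  rw [msgfemMap, h3, sub_zero, h2, add_zero]

theorem localSolves_mem (hp : 1 ≤ p) (v : E d → ℝ) : localSolves T p A D v ∈ feSpace T p :=
  Submodule.sum_mem _ fun i _ => pou_mem D hp i _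

theorem msgfemMap_mem (hd : 0 < d) (hp : 1 ≤ p) (hA : IsCoefficient T.domain A)
    {N : Fin M → ℕ} (φ : (i : Fin M) → Fin (N i) → E d → ℝ)
    (m : Fin M → ℕ) {v : E d → ℝ} (hv : v ∈ feSpace T p) :
    msgfemMap T p A D φ m v ∈ feSpace T p := by
  have h := localSolves_mem (A := A) D hp v
  exact Submodule.add_mem _ h (globalSubmodule_le D hp φ m
    (aProj_global_spec D hd hp hA φ m (Submodule.sub_mem _ hv h)).1)

/-- The residual of the local solve is `a`-harmonic. -/
theorem restr_mem_harmonicSpace (hA : IsCoefficient T.domain A) {i : Fin M} {v w : E d → ℝ}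
    (hv : v ∈ feSpace T p) (hw : w ∈ feSpace T p)
    (hwz : ∀ z ∈ localSpaceZero T p (D.ωs i),
      energyForm A (D.ωs i) w z = energyForm A T.domain v z) :
    restr (D.ωs i) (v - w) ∈ harmonicSpace T p A (D.ωs i) := by
  refine ⟨⟨v - w, Submodule.sub_mem _ hv hw, rfl⟩, fun z hz => ?_⟩
  have hs := (D.resolves_ωs i).subset_domain
  rw [energyForm_restr_left (D.resolves_ωs i).isOpen]
  have h1 := LinearMap.congr_fun (map_sub (energyBilin p hA hs) ⟨v, hv⟩ ⟨w, hw⟩) ⟨z, hz.1⟩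
  refine h1.trans ?_
  rw [LinearMap.sub_apply]
  simp only [energyBilin_apply]
  rw [hwz z hz, energyForm_domain_eq hs
    (ae_gradient_eq_zero_of_localSpaceZero (D.resolves_ωs i) hz), sub_self]

end Decomposition

/-! ### Spectral truncation and local approximation -/

/-- For a pencil of symmetric positive semidefinite forms, the part of a sum of eigenvectors which
belongs to the eigenvalues up to `μ` is bounded by the whole. -/
theorem spectral_truncation_le {V ι : Type*} [AddCommGroup V] [Module ℝ V] [Fintype ι]
    {b c : V →ₗ[ℝ] V →ₗ[ℝ] ℝ} (hb : ∀ x y, b x y = b y x) (hc : ∀ x y, c x y = c y x)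
    (hc0 : ∀ x, 0 ≤ c x x) {l : ι → ℝ≥0∞} {x : ι → V}
    (hx : ∀ j k, if l j = ∞ then c (x j) (x k) = 0
      else b (x j) (x k) = (l j).toReal * c (x j) (x k))
    {μ : ℝ} (hμ : 0 ≤ μ) {J : Finset ι} (hJ : ∀ j, j ∈ J ↔ l j ≤ ENNReal.ofReal μ) :
    b (∑ j ∈ J, x j) (∑ j ∈ J, x j) ≤ μ * c (∑ j, x j) (∑ j, x j) := by
  classical
  -- An eigenvector for ∞ is c-orthogonal to all the others. For two finite eigenvalues symmetry
  -- gives (l_j - l_k) c(x_j, x_k) = 0.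
  have horth : ∀ j k, l j ≠ l k → c (x j) (x k) = 0 := by
    intro j k hjk
    have h1 := hx j k
    have h2 := hx k j
    split_ifs at h1 h2 with hj hk hk
    · exact h1
    · exact h1
    · rw [hc]; exact h2
    · rw [hb, hc, h1] at h2
      have h3 : ((l j).toReal - (l k).toReal) * c (x j) (x k) = 0 := by
        rw [sub_mul, h2, hc, sub_self]
      rcases mul_eq_zero.1 h3 with h | h
      · exact absurd ((ENNReal.toReal_eq_toReal_iff' hj hk).1 (sub_eq_zero.1 h)) hjk
      · exact h
  have hJfin : ∀ j ∈ J, l j ≠ ∞ := fun j hj =>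
    ((hJ j).1 hj).trans_lt ENNReal.ofReal_lt_top |>.ne
  have hJle : ∀ j ∈ J, 0 ≤ μ - (l j).toReal := fun j hj =>
    sub_nonneg.2 (ENNReal.toReal_le_of_le_ofReal hμ ((hJ j).1 hj))
  set r := ∑ j ∈ J, x j with hr
  set s := ∑ j ∈ Jᶜ, x j with hs
  have hrs : ∑ j, x j = r + s := (Finset.sum_add_sum_compl J x).symm
  have hcrs : c r s = 0 := by
    simp only [hr, hs, map_sum, LinearMap.sum_apply]
    refine Finset.sum_eq_zero fun k hk => Finset.sum_eq_zero fun j hj => horth j k fun h => ?_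
    exact (Finset.mem_compl.1 hk) ((hJ k).2 (h ▸ (hJ j).1 hj))
  have h1 : c r r ≤ c (∑ j, x j) (∑ j, x j) := by
    rw [hrs]
    simp only [map_add, LinearMap.add_apply]
    rw [hc s r, hcrs]
    linarith [hc0 s]
  refine le_trans ?_ (mul_le_mul_of_nonneg_left h1 hμ)
  have hbr : b r r = ∑ j ∈ J, ∑ k ∈ J, (l j).toReal * c (x j) (x k) := by
    simp only [hr, map_sum, LinearMap.sum_apply]
    rw [Finset.sum_comm]
    refine Finset.sum_congr rfl fun j hj => Finset.sum_congr rfl fun k _ => ?_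
    have := hx j k
    rwa [if_neg (hJfin j hj)] at this
  have hcr : μ * c r r = ∑ j ∈ J, ∑ k ∈ J, μ * c (x j) (x k) := by
    simp only [hr, map_sum, LinearMap.sum_apply, Finset.mul_sum]
    exact Finset.sum_comm
  -- The c-energy of this vector is μ c(r, r) - b(r, r): pairs with equal eigenvalues contribute (μ
  -- - l_j) c(x_j, x_k), all others vanish. No orthogonality inside an eigenspace is needed.
  have hpos := hc0 (∑ j ∈ J, √(μ - (l j).toReal) • x j)
  have hexp : c (∑ j ∈ J, √(μ - (l j).toReal) • x j) (∑ j ∈ J, √(μ - (l j).toReal) • x j) =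
      ∑ j ∈ J, ∑ k ∈ J, (μ - (l j).toReal) * c (x j) (x k) := by
    simp only [map_sum, LinearMap.sum_apply, map_smul, LinearMap.smul_apply, smul_eq_mul,
      Finset.mul_sum]
    rw [Finset.sum_comm]
    refine Finset.sum_congr rfl fun j hj => Finset.sum_congr rfl fun k _ => ?_
    by_cases h : l j = l k
    · rw [← h, ← mul_assoc, Real.mul_self_sqrt (hJle j hj)]
    · rw [horth j k h]
      simp
  rw [hexp] at hpos
  simp only [sub_mul, Finset.sum_sub_distrib] at hpos
  rw [hbr, hcr]
  linarith

theorem lt_of_nextEigenvalue_lt {N : ℕ} {l : Fin N → ℝ≥0∞} (hl : Antitone l) {m : ℕ} {j : Fin N}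
    (h : nextEigenvalue l m < l j) : (j : ℕ) < m := by
  by_contra! hmj
  have hmN : m < N := hmj.trans_lt j.2
  rw [nextEigenvalue, dif_pos hmN] at h
  exact absurd (hl (show (⟨m, hmN⟩ : Fin N) ≤ j from hmj)) (not_le.2 h)

/-- The local approximation error of an `a`-harmonic function. -/
theorem exists_localApprox {M : ℕ} (D : Decomposition T M) (hp : 1 ≤ p)
    (hA : IsCoefficient T.domain A) {i : Fin M} {N : ℕ} {l : Fin N → ℝ≥0∞}
    {φ : Fin N → E d → ℝ} (hφ : IsEigenSystem T p A D i l φ) {m : ℕ} {μ : ℝ} (hμ : 0 ≤ μ)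
    (hm : nextEigenvalue l m ≤ ENNReal.ofReal μ) {ψ : E d → ℝ}
    (hψ : restr (D.ωs i) ψ ∈ harmonicSpace T p A (D.ωs i)) :
    ∃ f ∈ localApprox T D i φ m,
      energyForm A (D.ω i) (pou T p D i ψ - pou T p D i f) (pou T p D i ψ - pou T p D i f) ≤
        μ * energyForm A (D.ωs i) ψ ψ := by
  classical
  have hωs := (D.resolves_ωs i).subset_domain
  have hω := (D.resolves_ω i).subset_domain
  have hωso := (D.resolves_ωs i).isOpen
  have hφh : ∀ j, φ j ∈ harmonicSpace T p A (D.ωs i) := fun j => (hφ.eigenpair j).1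
  -- An eigenfunction is only the restriction of an element of V_h. Global representatives are fixed
  -- so that both forms can live on V_h, where they are merely semidefinite.
  choose Φ hΦ hΦφ using fun j => (hφh j).1
  rw [← hφ.span_eq] at hψ
  obtain ⟨a, ha⟩ := (Submodule.mem_span_range_iff_exists_fun ℝ).1 hψ
  let P : feSpace T p →ₗ[ℝ] feSpace T p :=
    ((pou T p D i).comp (Submodule.subtype _)).codRestrict _ fun v => pou_mem D hp i v
  let c := energyBilin p hA hωs
  let b := (energyBilin p hA hω).compl₁₂ P P
  let x : Fin N → feSpace T p := fun j => a j • ⟨Φ j, hΦ j⟩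
  let J : Finset (Fin N) := Finset.univ.filter fun j => l j ≤ ENNReal.ofReal μ
  have hpouΦ : ∀ j, pou T p D i (φ j) = pou T p D i (Φ j) := fun j => by
    rw [← hΦφ j, pou_restr D i (D.subset i)]
  have hc : ∀ j k, c ⟨Φ j, hΦ j⟩ ⟨Φ k, hΦ k⟩ = energyForm A (D.ωs i) (φ j) (φ k) := fun j k => by
    rw [← hΦφ j, ← hΦφ k, energyForm_restr_left hωso, energyForm_restr_right hωso]
    rfl
  have hb : ∀ j k, b ⟨Φ j, hΦ j⟩ ⟨Φ k, hΦ k⟩ =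
      energyForm A (D.ω i) (pou T p D i (restr (D.ω i) (φ j)))
        (pou T p D i (restr (D.ω i) (φ k))) := fun j k => by
    rw [pou_restr D i subset_rfl, pou_restr D i subset_rfl, hpouΦ, hpouΦ]
    rfl
  have hx : ∀ j k, if l j = ∞ then c (x j) (x k) = 0
      else b (x j) (x k) = (l j).toReal * c (x j) (x k) := fun j k => by
    have h := (hφ.eigenpair j).2.2 (φ k) (hφh k)
    rw [← hc, ← hb] at h
    simp only [x, map_smul, LinearMap.smul_apply, smul_eq_mul]
    split_ifs at h ⊢ with hj
    · rw [h]; ring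
    · rw [h]; ring
  have key := spectral_truncation_le (b := b) (c := c)
    (fun u v => energyForm_symm hA hω _ _) (fun u v => energyForm_symm hA hωs _ _)
    (fun u => energyForm_nonneg hA hωs _) hx hμ (J := J) (fun j => by simp [J])
  -- The approximant keeps exactly the components with eigenvalue above μ. These include all
  -- infinite ones and, by monotonicity, have index below m.
  refine ⟨∑ j ∈ Jᶜ, a j • restr (D.ω i) (φ j), Submodule.sum_mem _ fun j hj =>
    Submodule.smul_mem _ _ (Submodule.subset_span ⟨j, ?_, rfl⟩), ?_⟩
  · refine lt_of_nextEigenvalue_lt hφ.antitone (hm.trans_lt ?_)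
    simpa [J] using hj
  · have h1 : pou T p D i ψ - pou T p D i (∑ j ∈ Jᶜ, a j • restr (D.ω i) (φ j)) =
        P (∑ j ∈ J, x j) := by
      rw [← pou_restr D i (D.subset i) ψ, ← ha]
      simp only [map_sum, map_smul, pou_restr D i subset_rfl]
      rw [← Finset.sum_add_sum_compl J, add_sub_cancel_right]
      simp only [Submodule.coe_sum, x, map_smul, hpouΦ]
      rfl
    have h2 : energyForm A (D.ωs i) ψ ψ = c (∑ j, x j) (∑ j, x j) := by
      have hr : restr (D.ωs i) ψ = restr (D.ωs i) ((∑ j, x j : feSpace T p) : E d → ℝ) := by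
        rw [← ha]
        simp only [Submodule.coe_sum, map_sum, x, Submodule.coe_smul, map_smul, hΦφ]
      change _ = energyForm A (D.ωs i) ((∑ j, x j : feSpace T p) : E d → ℝ)
        ((∑ j, x j : feSpace T p) : E d → ℝ)
      rw [← energyForm_restr_left hωso, ← energyForm_restr_right hωso, hr,
        energyForm_restr_left hωso, energyForm_restr_right hωso]
    rw [h1, h2]
    exact key

/-! ### The contraction estimate -/

/-- The squared contraction estimate for the error propagation. -/
theorem energyForm_sub_msgfemMap_le {M : ℕ} (D : Decomposition T M) (hd : 0 < d) (hp : 1 ≤ p)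
    (hA : IsCoefficient T.domain A) {N : Fin M → ℕ} {l : (i : Fin M) → Fin (N i) → ℝ≥0∞}
    {φ : (i : Fin M) → Fin (N i) → E d → ℝ} (hφ : ∀ i, IsEigenSystem T p A D i (l i) (φ i))
    {m : Fin M → ℕ} {μ : ℝ} (hμ : 0 ≤ μ)
    (hm : ∀ i, nextEigenvalue (l i) (m i) ≤ ENNReal.ofReal μ)
    {e : E d → ℝ} (he : e ∈ feSpace T p) :
    energyForm A T.domain (e - msgfemMap T p A D φ m e) (e - msgfemMap T p A D φ m e) ≤
      overlap T.domain D.ω * overlap T.domain D.ωs * μ * energyForm A T.domain e e := by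
  set w : Fin M → E d → ℝ := fun i => aProj T A (D.ωs i) (localSpaceZero T p (D.ωs i)) e with hw
  have hwspec := fun i => aProj_local_spec D hd hp hA i he
  have hwm : ∀ i, w i ∈ feSpace T p := fun i => (hwspec i).1.1
  choose f hf hfe using fun i => exists_localApprox D hp hA (hφ i) hμ (hm i)
    (restr_mem_harmonicSpace D hA he (hwm i) (hwspec i).2)
  set g := e - localSolves T p A D e with hg
  have hgm : g ∈ feSpace T p := Submodule.sub_mem _ he (localSolves_mem D hp e)
  -- The partition of unity applied to e itself turns g into a sum of local residuals.
  have hgsum : g = ∑ i, pou T p D i (e - w i) := by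
    simp only [map_sub, Finset.sum_sub_distrib]
    rw [sum_pou D hp he, hg, localSolves]
    simp only [pou_restr D _ subset_rfl, hw]
  obtain ⟨hπ, hπz⟩ := aProj_global_spec D hd hp hA φ m hgm
  set π := aProj T A T.domain (globalApprox T p D φ m) g with hπdef
  have hπm := globalSubmodule_le D hp φ m hπ
  have hres : e - msgfemMap T p A D φ m e = g - π := by
    rw [msgfemMap, ← hg, ← hπdef, hg]
    abel
  set s := ∑ i, pou T p D i (f i) with hs
  have hsS : s ∈ globalSubmodule D p φ m := ⟨f, hf, rfl⟩
  have hsm := globalSubmodule_le D hp φ m hsS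
  -- the projection is the best approximation
  have hbest : energyForm A T.domain (g - π) (g - π) ≤ energyForm A T.domain (g - s) (g - s) := by
    let B := energyBilin p hA (subset_refl T.domain)
    let gv : feSpace T p := ⟨g, hgm⟩
    let πv : feSpace T p := ⟨π, hπm⟩
    let sv : feSpace T p := ⟨s, hsm⟩
    change B (gv - πv) (gv - πv) ≤ B (gv - sv) (gv - sv)
    have h1 : B πv (πv - sv) = B gv (πv - sv) := hπz _ (Submodule.sub_mem _ hπ hsS)
    have h2 : 0 ≤ B (πv - sv) (πv - sv) := energyForm_nonneg hA subset_rfl _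
    have h3 : B πv sv = B sv πv := energyForm_symm hA subset_rfl _ _
    have h4 : B πv gv = B gv πv := energyForm_symm hA subset_rfl _ _
    have h5 : B sv gv = B gv sv := energyForm_symm hA subset_rfl _ _
    simp only [map_sub, LinearMap.sub_apply] at h1 h2 ⊢
    linarith
  have hgs : g - s = ∑ i, (pou T p D i (e - w i) - pou T p D i (f i)) := by
    rw [Finset.sum_sub_distrib, hgsum]
  have hsum : energyForm A T.domain (g - s) (g - s) ≤ overlap T.domain D.ω *
      ∑ i, energyForm A (D.ω i) (pou T p D i (e - w i) - pou T p D i (f i))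
        (pou T p D i (e - w i) - pou T p D i (f i)) := by
    rw [hgs]
    simp only [← map_sub]
    exact energyForm_sum_le hA (fun i => (D.resolves_ω i).subset_domain)
      (fun i => pou_mem D hp i _) (fun i => ae_gradient_pou D hp i _)
  have hloc : ∀ i, energyForm A (D.ωs i) (e - w i) (e - w i) ≤ energyForm A (D.ωs i) e e := by
    intro i
    have hsub := (D.resolves_ωs i).subset_domain
    let B := energyBilin p hA hsub
    let ev : feSpace T p := ⟨e, he⟩
    let wv : feSpace T p := ⟨w i, hwm i⟩
    change B (ev - wv) (ev - wv) ≤ B ev ev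
    -- Testing the projection with itself; Pythagoras then gives a(e - w_i, e - w_i) = a(e, e) -
    -- a(w_i, w_i) on ω_i^*.
    have h1 : B wv wv = B ev wv := by
      refine ((hwspec i).2 _ (hwspec i).1).trans ?_
      exact energyForm_domain_eq hsub
        (ae_gradient_eq_zero_of_localSpaceZero (D.resolves_ωs i) (hwspec i).1) e
    have h2 : 0 ≤ B wv wv := energyForm_nonneg hA hsub _
    have h3 : B wv ev = B ev wv := energyForm_symm hA hsub _ _
    simp only [map_sub, LinearMap.sub_apply]
    linarith
  have hover := sum_energyForm_le hA (fun i => (D.resolves_ωs i).subset_domain)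
    (fun i => (D.resolves_ωs i).isOpen) he
  rw [hres]
  calc energyForm A T.domain (g - π) (g - π)
      ≤ overlap T.domain D.ω * ∑ i, energyForm A (D.ω i)
          (pou T p D i (e - w i) - pou T p D i (f i))
          (pou T p D i (e - w i) - pou T p D i (f i)) := hbest.trans hsum
    _ ≤ overlap T.domain D.ω * ∑ i, μ * energyForm A (D.ωs i) e e := by
        gcongr with i _
        exact (hfe i).trans (mul_le_mul_of_nonneg_left (hloc i) hμ)
    _ = overlap T.domain D.ω * (μ * ∑ i, energyForm A (D.ωs i) e e) := by
        simp only [Finset.mul_sum]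
    _ ≤ overlap T.domain D.ω * (μ * (overlap T.domain D.ωs * energyForm A T.domain e e)) := by
        gcongr
    _ = _ := by ring

theorem overlap_ne_zero {M : ℕ} {Ω : Set (E d)} {U : Fin M → Set (E d)} {x : E d} (hx : x ∈ Ω)
    {i : Fin M} (hi : x ∈ U i) : overlap Ω U ≠ 0 := by
  have h1 := ncard_le_overlap U hx
  have h2 : 0 < {i | x ∈ U i}.ncard := (Set.ncard_pos (Set.toFinite _)).2 ⟨i, hi⟩
  omega

end

end MSGFEM

theorem proposition3p3 {d : ℕ} (hd : d = 2 ∨ d = 3)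
    -- the triangulated domain, the polynomial degree and the coefficient
    (T : MSGFEM.Triangulation d) (hΩ : IsConnected T.domain) (p : ℕ) (hp : 1 ≤ p)
    (A : MSGFEM.E d → Matrix (Fin d) (Fin d) ℝ) (hA : MSGFEM.IsCoefficient T.domain A)
    -- the overlapping decomposition with oversampling domains and partition of unity
    {M : ℕ} (D : MSGFEM.Decomposition T M)
    -- for each `i`, the eigenvalues and eigenfunctions of the local eigenproblem, and `m_i`
    {N : Fin M → ℕ} (l : (i : Fin M) → Fin (N i) → ℝ≥0∞)
    (φ : (i : Fin M) → Fin (N i) → MSGFEM.E d → ℝ)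
    (hφ : ∀ i, MSGFEM.IsEigenSystem T p A D i (l i) (φ i)) (m : Fin M → ℕ)
    -- the discrete solution
    (ℓ : MSGFEM.feSpace T p →ₗ[ℝ] ℝ) (uh : MSGFEM.E d → ℝ) (huh : uh ∈ MSGFEM.feSpace T p)
    (hsol : ∀ w : MSGFEM.feSpace T p, MSGFEM.energyForm A T.domain uh w = ℓ w)
    -- the iteration
    (v : ℕ → MSGFEM.E d → ℝ) (hv0 : v 0 ∈ MSGFEM.feSpace T p)
    (hv : ∀ j, v (j + 1) = v j + MSGFEM.msgfemMap T p A D φ m (uh - v j)) :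
    ∀ j, ENNReal.ofReal (MSGFEM.energyNorm A T.domain (v (j + 1) - uh)) ≤
      MSGFEM.errorBound D l m * ENNReal.ofReal (MSGFEM.energyNorm A T.domain (v j - uh)) := by
  have hd0 : 0 < d := by omega
  have hvm : ∀ j, v j ∈ MSGFEM.feSpace T p := by
    intro j
    induction j with
    | zero => exact hv0
    | succ j ih =>
      rw [hv]
      exact Submodule.add_mem _ ih
        (MSGFEM.msgfemMap_mem D hd0 hp hA φ m (Submodule.sub_mem _ huh ih))
  intro j
  set e := uh - v j with he
  have hem : e ∈ MSGFEM.feSpace T p := Submodule.sub_mem _ huh (hvm j)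
  have hGm := MSGFEM.msgfemMap_mem D hd0 hp hA φ m hem
  have hneg : ∀ u ∈ MSGFEM.feSpace T p, MSGFEM.energyNorm A T.domain (-u) =
      MSGFEM.energyNorm A T.domain u := by
    intro u hu
    let B := MSGFEM.energyBilin p hA (subset_refl T.domain)
    let u' : MSGFEM.feSpace T p := ⟨u, hu⟩
    have h : B (-u') (-u') = B u' u' := by simp
    exact congrArg Real.sqrt h
  have h1 : v (j + 1) - uh = -(e - MSGFEM.msgfemMap T p A D φ m e) := by
    rw [hv, he]; abel
  have h2 : v j - uh = -e := by rw [he]; abel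
  rw [h1, h2, hneg _ (Submodule.sub_mem _ hem hGm), hneg _ hem]
  obtain ⟨x, hx⟩ := hΩ.nonempty
  obtain ⟨i, hi⟩ := Set.mem_iUnion.1 (D.cover ▸ hx : x ∈ ⋃ i, D.ω i)
  -- A point of Ω makes both overlaps nonzero, so an infinite eigenvalue really gives Λ = ∞.
  have hξ : (MSGFEM.overlap T.domain D.ω : ℝ≥0∞) * (MSGFEM.overlap T.domain D.ωs : ℝ≥0∞) ≠ 0 :=
    mul_ne_zero (by exact_mod_cast MSGFEM.overlap_ne_zero hx hi)
      (by exact_mod_cast MSGFEM.overlap_ne_zero hx (D.subset i hi))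
  rw [MSGFEM.errorBound]
  by_cases hsup : (⨆ i, MSGFEM.nextEigenvalue (l i) (m i)) = ∞
  -- With Λ = ∞ only an error of zero energy needs an argument, since ∞ · 0 = 0: then e = 0 by
  -- definiteness, and G(0) = 0.
  · by_cases he0 : MSGFEM.energyForm A T.domain e e = 0
    · have hez : e = 0 := MSGFEM.eq_zero_of_energyForm hd0 hA hem he0
      rw [hez, MSGFEM.msgfemMap_zero D hd0 hp hA φ m, sub_zero, ← hez, MSGFEM.energyNorm, he0]
      simp
    · have hpos : 0 < MSGFEM.energyNorm A T.domain e :=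
        Real.sqrt_pos.2 (lt_of_le_of_ne (MSGFEM.energyForm_nonneg hA subset_rfl e) (Ne.symm he0))
      rw [hsup, ENNReal.mul_top hξ, ENNReal.top_rpow_of_pos (by norm_num),
        ENNReal.top_mul (ENNReal.ofReal_pos.2 hpos).ne']
      exact le_top
  · set μ := (⨆ i, MSGFEM.nextEigenvalue (l i) (m i)).toReal with hμ
    have hμ0 : 0 ≤ μ := ENNReal.toReal_nonneg
    have hsupμ : (⨆ i, MSGFEM.nextEigenvalue (l i) (m i)) = ENNReal.ofReal μ :=
      (ENNReal.ofReal_toReal hsup).symm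
    have hmain := MSGFEM.energyForm_sub_msgfemMap_le D hd0 hp hA hφ hμ0
      (fun i => hsupμ ▸ le_iSup (fun i => MSGFEM.nextEigenvalue (l i) (m i)) i) hem
    have hbound : ((MSGFEM.overlap T.domain D.ω : ℝ≥0∞) * (MSGFEM.overlap T.domain D.ωs : ℝ≥0∞) *
        ⨆ i, MSGFEM.nextEigenvalue (l i) (m i)) ^ (1 / 2 : ℝ) =
        ENNReal.ofReal √(MSGFEM.overlap T.domain D.ω * MSGFEM.overlap T.domain D.ωs * μ) := by
      rw [hsupμ, Real.sqrt_eq_rpow, ← ENNReal.ofReal_rpow_of_nonneg (by positivity) (by norm_num),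
        ENNReal.ofReal_mul (by positivity), ENNReal.ofReal_mul (by positivity),
        ENNReal.ofReal_natCast, ENNReal.ofReal_natCast]
    rw [hbound, ← ENNReal.ofReal_mul (Real.sqrt_nonneg _)]
    refine ENNReal.ofReal_le_ofReal ?_
    rw [MSGFEM.energyNorm, MSGFEM.energyNorm, ← Real.sqrt_mul (by positivity)]
    exact Real.sqrt_le_sqrt hmain
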